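/- Let $\mathbf{f}=(f_1,f_2,f_3)$ be a triple of power series in $\mathbb{C}[[t]]$ without constant term. Its value semigroup is the set of all $t$-adic valuations of nonzero elements of the image of $\mathbb{C}[[x_1,x_2,x_3]]\to\mathbb{C}[[t]]$, $x_i\mapsto f_i(t)$. For $m\geq 1$ let ${\rm S}_{\rm gen}={\rm S}_{\rm gen}(m)$ denote the value semigroup of a generic triple with $v_t(f_1)=2m$, $v_t(f_2)=2m+2$, $v_t(f_3)=2m+4$; that is, the semigroup common to all such triples whose coefficients lie outside the zero locus of some nonzero polynomial in the coefficients $[t^{v_t(f_i)+j}]f_i$ ($1\le i\le 3$, $j\geq 0$). Let $M^3_d$ be the space of nondegenerate morphisms $\mathbb{P}^1\to\mathbb{P}^3$ of degree $d$ over $\mathbb{C}$, each identified with the set of coefficients of its four homogeneous parameterizing polynomials, and let $M^3_{d,g;{\rm S}}\subset M^3_d$ be the locus of those morphisms that are injective and whose image has arithmetic genus $g$ and exactly one singular point, with value semigroup ${\rm S}$ there. For every integer $m\geq 9$, the generic value semigroup ${\rm S}_{\rm gen}$ is well defined (it exists and is unique) and has finite complement in $\mathbb{N}$, and, with $g=\#(\mathbb{N}\setminus{\rm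 S}_{\rm gen})$, the Severi variety $M^3_{d,g;{\rm S}_{\rm gen}}$ has codimension strictly less than $g$ in $M^3_d$ for all $d\gg g$ (that is, for all $d\geq D(g)$, where $D(g)$ depends only on $g$); in particular it is nonempty for such $d$, the codimension of the empty set being $\infty$. -/

import Mathlib

namespace Severi

noncomputable section

/-- The set of valuations `v_t(φ(G))` of the nonzero elements of the image of the ring map
`φ : ℂ[[x₁,…,xₙ]] → ℂ[[t]]`, `xᵢ ↦ fᵢ(t)`, for power series `fᵢ` without constant term. -/
def valueSemigroup {n : ℕ} (f : Fin n → PowerSeries ℂ) : Set ℕ :=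
  {v : ℕ | ∃ G : MvPowerSeries (Fin n) ℂ,
    PowerSeries.order (MvPowerSeries.subst f G : PowerSeries ℂ) = (v : ℕ∞)}

/-- `S` is the value semigroup of a generic parameterization `f = (f₁,…,fₙ)` with
`v_t(fᵢ) = kᵢ`: writing `fᵢ = t ^ kᵢ * aᵢ(t)` with `aᵢ(0) ≠ 0`, every such `f` outside the
vanishing locus of some nonzero polynomial in the coefficients of the `aᵢ` has value
semigroup `S`. -/
def IsGenericValueSemigroup {n : ℕ} (k : Fin n → ℕ) (S : Set ℕ) : Prop :=
  ∃ Φ : MvPolynomial (Fin n × ℕ) ℂ, Φ ≠ 0 ∧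
    ∀ a : Fin n → PowerSeries ℂ,
      (∀ i, PowerSeries.constantCoeff (a i) ≠ 0) →
      MvPolynomial.eval (fun x : Fin n × ℕ => PowerSeries.coeff x.2 (a x.1)) Φ ≠ 0 →
      valueSemigroup (fun i => PowerSeries.X ^ k i * a i) = S

/-- The affine space of `(n+1)`-tuples of binary forms of degree `d`, given by their
coefficients: `c` stands for the forms `Fᵢ(s, u) = ∑ⱼ c (i, j) s ^ j u ^ (d - j)`. -/
abbrev Forms (n d : ℕ) : Type := Fin (n + 1) × Fin (d + 1) → ℂ

/-- Expansion of the forms `Fᵢ` at a point `p` of `ℙ¹ = ℂ ∪ {∞}`: it is `Fᵢ(z + t, 1)` at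
`p = z = (z : 1)` and `Fᵢ(1, t)` at `p = ∞ = (1 : 0)`. -/
def expansion {n d : ℕ} (c : Forms n d) (p : OnePoint ℂ) (i : Fin (n + 1)) : PowerSeries ℂ :=
  p.elim
    (∑ j : Fin (d + 1), PowerSeries.C (c (i, j)) * PowerSeries.X ^ (d - (j : ℕ)))
    (fun z => ∑ j : Fin (d + 1),
      PowerSeries.C (c (i, j)) * (PowerSeries.C z + PowerSeries.X) ^ (j : ℕ))

/-- The homogeneous coordinates of the image of `p`. -/
def value {n d : ℕ} (c : Forms n d) (p : OnePoint ℂ) : Fin (n + 1) → ℂ :=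
  fun i => PowerSeries.constantCoeff (expansion c p i)

/-- The space `M^n_d` of nondegenerate morphisms `ℙ¹ → ℙⁿ` of degree `d`, each identified with
the coefficients of its parameterizing forms: these have no common zero, and the image lies in
no hyperplane. -/
def maps (n d : ℕ) : Set (Forms n d) :=
  {c | (∀ p : OnePoint ℂ, value c p ≠ 0) ∧
    LinearIndependent ℂ (fun (i : Fin (n + 1)) (j : Fin (d + 1)) => c (i, j))}

/-- The morphism `ℙ¹ → ℙⁿ` given by a point of `M^n_d`. -/
def toMap {n d : ℕ} (c : Forms n d) (hc : c ∈ maps n d) (p : OnePoint ℂ) :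
    Projectivization ℂ (Fin (n + 1) → ℂ) :=
  Projectivization.mk ℂ (value c p) (hc.1 p)

/-- Affine coordinates of the morphism near `p`, in the chart where the `j`-th homogeneous
coordinate does not vanish, centred at the image of `p`. -/
def germ {n d : ℕ} (c : Forms n d) (p : OnePoint ℂ) (j : Fin (n + 1)) (i : Fin n) :
    PowerSeries ℂ :=
  expansion c p (j.succAbove i) * (expansion c p j)⁻¹
    - PowerSeries.C (value c p (j.succAbove i) * (value c p j)⁻¹)

/-- The value semigroup of the branch of the morphism at `p`. It does not depend on the affine
chart `j` around the image of `p`. -/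
def valueSemigroupAt {n d : ℕ} (c : Forms n d) (p : OnePoint ℂ) : Set ℕ :=
  {v | ∃ j : Fin (n + 1), value c p j ≠ 0 ∧ v ∈ valueSemigroup (germ c p j)}

/-- The arithmetic genus of the image of an injective morphism, i.e. of a rational curve all of
whose points are unibranch: the sum of the local genera `δ_P = #(ℕ \ S_P)`. -/
def arithGenus {n d : ℕ} (c : Forms n d) : ℕ∞ :=
  ∑ᶠ p : OnePoint ℂ, (valueSemigroupAt c p)ᶜ.encard

/-- `M^n_{d,g;S}`: the unicuspidal rational curves of arithmetic genus `g` whose cusp has value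
semigroup `S`. The morphism is injective (all points of the image are unibranch), and exactly one
point of the image is singular (the smooth points are those with value semigroup `ℕ`). -/
def severi (n d g : ℕ) (S : Set ℕ) : Set (Forms n d) :=
  {c | ∃ hc : c ∈ maps n d, Function.Injective (toMap c hc) ∧ arithGenus c = (g : ℕ∞) ∧
    ∃ p : OnePoint ℂ, valueSemigroupAt c p = S ∧ S ≠ Set.univ ∧
      ∀ q : OnePoint ℂ, q ≠ p → valueSemigroupAt c q = Set.univ}

/-- The codimension of (the Zariski closure of) `V` in (the Zariski closure of) `M`, for subsets
`V ⊆ M` of an affine space over `ℂ`: the height, in the coordinate ring of the closure of `M`, of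
the ideal of the functions that vanish on `V`. It is the minimum of the codimensions of the
irreducible components, and it is `⊤` if `V` is empty. -/
def codim {σ : Type*} (V M : Set (σ → ℂ)) : ℕ∞ :=
  ((MvPolynomial.vanishingIdeal ℂ V).map
    (Ideal.Quotient.mk (MvPolynomial.vanishingIdeal ℂ M))).height

end

end Severi

/-!
Whether `v` is a value of `f` is the solvability of a linear system in finitely many coefficients of
`f`, so it holds generically or fails generically. The values `2m`, `2m + 2` and, because of the
relation `2m + (2m + 4) = 2 (2m + 2)`, also `4m + 5` are attained generically. As their gcd is `1`,
only finitely many `v` are left to decide, and the generic semigroup `S` exists.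

Its genus `g` is large: power series of order at least `2m` have only `35` monomials of degree at
most `4`, and these span all the values below `10m`. Hence `g ≥ 10m - 35 > 6m` for `m ≥ 9`.

The codimension is at most `6m`. For `d ≫ 0`, forms `F₀, …, F₃` that vanish at `0` to the orders
`0, 2m, 2m + 2, 2m + 4` and are otherwise generic have value semigroup `S` at `0` and define an
injective immersion elsewhere. Up to the action of `GL₄`, every tuple of forms whose coefficients in
the columns `kᵢ = 0, 2m, 2m + 2, 2m + 4` form an invertible block becomes such a degenerate tuple
after imposing, on its row reduction, the vanishing of the `∑ᵢ (kᵢ - i) = 6m` entries which precede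
the pivots.
-/

namespace Severi

noncomputable section

open Filter
open MvPolynomial (eval)
open scoped Matrix PowerSeries

section Generic

variable {σ R : Type*} [CommRing R] [IsDomain R]

/-- The filter of the sets of points of affine space that contain the complement of some
hypersurface: `∀ᶠ x in generic σ R, p x` says that the generic point has the property `p`. -/
def generic (σ R : Type*) [CommRing R] [IsDomain R] : Filter (σ → R) where
  sets := {U | ∃ Ψ : MvPolynomial σ R, Ψ ≠ 0 ∧ ∀ x, eval x Ψ ≠ 0 → x ∈ U}
  univ_sets := ⟨1, one_ne_zero, fun _ _ => Set.mem_univ _⟩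
  sets_of_superset := fun ⟨Ψ, hΨ, h⟩ hUV => ⟨Ψ, hΨ, fun x hx => hUV (h x hx)⟩
  inter_sets := fun ⟨Ψ, hΨ, h⟩ ⟨Ψ', hΨ', h'⟩ => ⟨Ψ * Ψ', mul_ne_zero hΨ hΨ', fun x hx => by
    rw [map_mul] at hx
    exact ⟨h x (left_ne_zero_of_mul hx), h' x (right_ne_zero_of_mul hx)⟩⟩

theorem eventually_generic_iff {p : (σ → R) → Prop} :
    (∀ᶠ x in generic σ R, p x) ↔
      ∃ Ψ : MvPolynomial σ R, Ψ ≠ 0 ∧ ∀ x, eval x Ψ ≠ 0 → p x :=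
  Iff.rfl

theorem frequently_generic_iff {p : (σ → R) → Prop} :
    (∃ᶠ x in generic σ R, p x) ↔
      ∀ Ψ : MvPolynomial σ R, Ψ ≠ 0 → ∃ x, eval x Ψ ≠ 0 ∧ p x := by
  rw [Filter.Frequently, eventually_generic_iff]
  push Not
  rfl

instance [Infinite R] : (generic σ R).NeBot := by
  refine neBot_iff.2 fun h => ?_
  obtain ⟨Ψ, hΨ, hempty⟩ : ∅ ∈ generic σ R := empty_mem_iff_bot.2 h
  exact hΨ (MvPolynomial.funext fun x => by simpa using not_not.1 (mt (hempty x) id))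

theorem eventually_eval_ne_zero {Ψ : MvPolynomial σ R} (hΨ : Ψ ≠ 0) :
    ∀ᶠ x in generic σ R, eval x Ψ ≠ 0 :=
  ⟨Ψ, hΨ, fun _ => id⟩

theorem eventually_eval_ne_zero_of_eval_ne_zero {Ψ : MvPolynomial σ R} {x₀ : σ → R}
    (h : eval x₀ Ψ ≠ 0) : ∀ᶠ x in generic σ R, eval x Ψ ≠ 0 :=
  eventually_eval_ne_zero fun h0 => h (by rw [h0, map_zero])

theorem eventually_coord_ne_zero (s : σ) : ∀ᶠ x in generic σ R, x s ≠ 0 := by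
  simpa only [MvPolynomial.eval_X] using
    eventually_eval_ne_zero (MvPolynomial.X_ne_zero (R := R) s)

theorem eq_zero_of_frequently_eval_eq_zero {Ψ : MvPolynomial σ R}
    (h : ∃ᶠ x in generic σ R, eval x Ψ = 0) : Ψ = 0 := by
  by_contra hΨ
  exact h (eventually_eval_ne_zero hΨ)

end Generic

section BranchRing

variable {n m : ℕ} {f : Fin n → ℂ⟦X⟧} {g : Fin m → ℂ⟦X⟧}
  (hf : ∀ i, (f i).constantCoeff = 0) (hg : ∀ i, (g i).constantCoeff = 0)

/-- The complete local ring `ℂ⟦f₁, …, fₙ⟧ ⊆ ℂ⟦t⟧` of the branch parameterized by `f`: the value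
semigroup of `f` is the set of the orders of its elements. -/
def branchRing {n : ℕ} {f : Fin n → ℂ⟦X⟧} (hf : ∀ i, (f i).constantCoeff = 0) :
    Subalgebra ℂ ℂ⟦X⟧ :=
  (MvPowerSeries.substAlgHom (R := ℂ) (MvPowerSeries.hasSubst_of_constantCoeff_zero hf)).range

theorem mem_branchRing_iff {y : ℂ⟦X⟧} :
    y ∈ branchRing hf ↔ ∃ G : MvPowerSeries (Fin n) ℂ, MvPowerSeries.subst f G = y := by
  simp only [branchRing, AlgHom.mem_range, MvPowerSeries.coe_substAlgHom]

theorem mem_valueSemigroup_iff {v : ℕ} :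
    v ∈ valueSemigroup f ↔ ∃ y ∈ branchRing hf, y.order = v :=
  ⟨fun ⟨G, hG⟩ => ⟨_, (mem_branchRing_iff hf).2 ⟨G, rfl⟩, hG⟩, fun ⟨_, hy, hv⟩ => by
    obtain ⟨G, rfl⟩ := (mem_branchRing_iff hf).1 hy
    exact ⟨G, hv⟩⟩

theorem self_mem_branchRing (i : Fin n) : f i ∈ branchRing hf :=
  (mem_branchRing_iff hf).2
    ⟨MvPowerSeries.X i, MvPowerSeries.subst_X (MvPowerSeries.hasSubst_of_constantCoeff_zero hf) i⟩

theorem C_mem_branchRing (r : ℂ) : PowerSeries.C r ∈ branchRing hf :=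
  (branchRing hf).algebraMap_mem r

include hf in
theorem constantCoeff_subst (G : MvPowerSeries (Fin n) ℂ) :
    PowerSeries.constantCoeff (MvPowerSeries.subst f G : ℂ⟦X⟧) = G.constantCoeff := by
  have hs := MvPowerSeries.hasSubst_of_constantCoeff_zero hf
  have hC : MvPowerSeries.subst f (MvPowerSeries.C G.constantCoeff) =
      (PowerSeries.C G.constantCoeff : ℂ⟦X⟧) := by
    rw [← MvPowerSeries.coe_substAlgHom hs]
    exact (MvPowerSeries.substAlgHom (R := ℂ) hs).commutes G.constantCoeff
  have h0 : PowerSeries.constantCoeff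
      (MvPowerSeries.subst f (G - MvPowerSeries.C G.constantCoeff) : ℂ⟦X⟧) = 0 :=
    MvPowerSeries.constantCoeff_subst_eq_zero hs hf (by simp)
  rw [← MvPowerSeries.coe_substAlgHom hs, map_sub, MvPowerSeries.coe_substAlgHom hs, hC] at h0
  simpa [sub_eq_zero] using h0

theorem inv_mem_branchRing {y : ℂ⟦X⟧} (hy : y ∈ branchRing hf) (h0 : y.constantCoeff ≠ 0) :
    y⁻¹ ∈ branchRing hf := by
  obtain ⟨G, rfl⟩ := (mem_branchRing_iff hf).1 hy
  have hG : G.constantCoeff ≠ 0 := by rwa [← constantCoeff_subst hf]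
  have hs := MvPowerSeries.hasSubst_of_constantCoeff_zero hf
  refine (mem_branchRing_iff hf).2 ⟨G⁻¹, (PowerSeries.eq_inv_iff_mul_eq_one h0).2 ?_⟩
  rw [← MvPowerSeries.coe_substAlgHom hs]
  exact (map_mul _ _ _).symm.trans (by rw [MvPowerSeries.inv_mul_cancel G hG, map_one])

theorem branchRing_le (h : ∀ i, g i ∈ branchRing hf) : branchRing hg ≤ branchRing hf := by
  choose G hG using fun i => (mem_branchRing_iff hf).1 (h i)
  have hG0 : ∀ i, (G i).constantCoeff = 0 := fun i => by
    rw [← constantCoeff_subst hf, hG, hg]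
  intro y hy
  obtain ⟨H, rfl⟩ := (mem_branchRing_iff hg).1 hy
  refine (mem_branchRing_iff hf).2 ⟨MvPowerSeries.subst G H, ?_⟩
  rw [MvPowerSeries.subst_comp_subst_apply (R := ℂ)
    (MvPowerSeries.hasSubst_of_constantCoeff_zero hG0)
    (MvPowerSeries.hasSubst_of_constantCoeff_zero hf)]
  exact congrArg (MvPowerSeries.subst · H) (funext hG)

include hg in
theorem valueSemigroup_subset (h : ∀ i, g i ∈ branchRing hf) :
    valueSemigroup g ⊆ valueSemigroup f := fun _ hv =>
  let ⟨y, hy, hyv⟩ := (mem_valueSemigroup_iff hg).1 hv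
  (mem_valueSemigroup_iff hf).2 ⟨y, branchRing_le hf hg h hy, hyv⟩

/-- The value semigroup as a submonoid of `ℕ`. -/
def valueSubmonoid {n : ℕ} {f : Fin n → ℂ⟦X⟧} (hf : ∀ i, (f i).constantCoeff = 0) :
    AddSubmonoid ℕ where
  carrier := valueSemigroup f
  zero_mem' := (mem_valueSemigroup_iff hf).2 ⟨1, one_mem _, PowerSeries.order_one⟩
  add_mem' := by
    intro v w hv hw
    obtain ⟨y, hy, hyv⟩ := (mem_valueSemigroup_iff hf).1 hv
    obtain ⟨z, hz, hzw⟩ := (mem_valueSemigroup_iff hf).1 hw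
    exact (mem_valueSemigroup_iff hf).2
      ⟨y * z, mul_mem hy hz, by rw [PowerSeries.order_mul, hyv, hzw, Nat.cast_add]⟩

include hf in
theorem valueSemigroup_eq_univ {i : Fin n} (h : PowerSeries.coeff 1 (f i) ≠ 0) :
    valueSemigroup f = Set.univ := by
  have h1 : 1 ∈ valueSubmonoid hf := by
    refine (mem_valueSemigroup_iff hf).2 ⟨f i, self_mem_branchRing hf i,
      PowerSeries.order_eq_nat.2 ⟨h, fun j hj => ?_⟩⟩
    rw [Nat.lt_one_iff.1 hj, PowerSeries.coeff_zero_eq_constantCoeff_apply, hf]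
  refine Set.eq_univ_of_forall fun v => ?_
  rw [← mul_one v]
  exact (valueSubmonoid hf).nsmul_mem h1 v

end BranchRing

section Monomials

variable {n : ℕ} {R : Type*} [CommRing R]

/-- The monomial `f ^ e = ∏ i, f i ^ e i` in a family of power series. -/
def monomialSeries (f : Fin n → R⟦X⟧) (e : Fin n →₀ ℕ) : R⟦X⟧ :=
  e.prod fun i j => f i ^ j

theorem le_order_monomialSeries {f : Fin n → R⟦X⟧} {κ : ℕ} (hf : ∀ i, κ ≤ (f i).order)
    (e : Fin n →₀ ℕ) : (e.degree * κ : ℕ) ≤ (monomialSeries f e).order := calc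
  ((e.degree * κ : ℕ) : ℕ∞) = ∑ i ∈ e.support, e i • (κ : ℕ∞) := by
    simp [Finsupp.degree_apply, Finset.sum_mul]
  _ ≤ ∑ i ∈ e.support, (f i ^ e i).order := Finset.sum_le_sum fun i _ =>
    (nsmul_le_nsmul_right (hf i) _).trans (PowerSeries.le_order_pow _ _)
  _ ≤ (monomialSeries f e).order := PowerSeries.le_order_prod _ _

/-- The exponents of the monomials of degree at most `r` in `n` variables. -/
def exponents (n r : ℕ) : Finset (Fin n →₀ ℕ) :=
  (Finset.range (r + 1)).biUnion fun j => Finset.univ.finsuppAntidiag j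

theorem mem_exponents {r : ℕ} {e : Fin n →₀ ℕ} : e ∈ exponents n r ↔ e.degree ≤ r := by
  simp [exponents, Finsupp.degree_eq_sum]

theorem card_exponents_le (n r : ℕ) : (exponents n r).card ≤ (r + n).choose n := by
  refine Finset.card_biUnion_le.trans_eq ?_
  simp only [Finset.card_finsuppAntidiag_nat_eq_multichoose, Finset.card_univ, Fintype.card_fin,
    Nat.sum_range_multichoose]

theorem lt_order_monomialSeries {f : Fin n → R⟦X⟧} {κ r : ℕ} (hf : ∀ i, κ ≤ (f i).order)
    {e : Fin n →₀ ℕ} (he : e ∉ exponents n r) {v : ℕ} (hv : v < κ * (r + 1)) :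
    v < (monomialSeries f e).order := by
  refine lt_of_lt_of_le (Nat.cast_lt.2 ?_) (le_order_monomialSeries hf e)
  rw [mem_exponents, not_le] at he
  exact hv.trans_le (by rw [mul_comm]; gcongr; exact he)

variable {f : Fin n → ℂ⟦X⟧}

theorem coeff_subst_eq (hf : ∀ i, (f i).constantCoeff = 0) (G : MvPowerSeries (Fin n) ℂ) {j : ℕ}
    {T : Finset (Fin n →₀ ℕ)} (hT : ∀ e ∉ T, PowerSeries.coeff j (monomialSeries f e) = 0) :
    PowerSeries.coeff j (MvPowerSeries.subst f G : ℂ⟦X⟧) =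
      PowerSeries.coeff j (∑ e ∈ T, MvPowerSeries.coeff e G • monomialSeries f e) := by
  have hs := MvPowerSeries.hasSubst_of_constantCoeff_zero hf
  refine (MvPowerSeries.coeff_subst hs G (Finsupp.single () j)).trans ?_
  simp only [map_sum, map_smul]
  refine finsum_eq_sum_of_support_subset _ fun e he => ?_
  by_contra heT
  exact he (by rw [← smul_zero (MvPowerSeries.coeff e G), ← hT e heT]; rfl)

theorem mem_valueSemigroup_iff_exists_sum (hf : ∀ i, (f i).constantCoeff = 0) {v : ℕ}
    {T : Finset (Fin n →₀ ℕ)} (hT : ∀ e ∉ T, v < (monomialSeries f e).order) :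
    v ∈ valueSemigroup f ↔ ∃ w : T → ℂ, (∑ e, w e • monomialSeries f e).order = v := by
  have horder : ∀ G : MvPowerSeries (Fin n) ℂ,
      PowerSeries.order (MvPowerSeries.subst f G : ℂ⟦X⟧) = v ↔
        (∑ e : T, MvPowerSeries.coeff (e : Fin n →₀ ℕ) G • monomialSeries f e).order = v := by
    intro G
    have hcoeff : ∀ j ≤ v, PowerSeries.coeff j (MvPowerSeries.subst f G : ℂ⟦X⟧) =
        PowerSeries.coeff j
          (∑ e : T, MvPowerSeries.coeff (e : Fin n →₀ ℕ) G • monomialSeries f e) := by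
      intro j hj
      rw [Finset.sum_coe_sort T fun e => MvPowerSeries.coeff e G • monomialSeries f e]
      exact coeff_subst_eq hf G fun e he =>
        PowerSeries.coeff_of_lt_order _ ((Nat.cast_le.2 hj).trans_lt (hT e he))
    rw [PowerSeries.order_eq_nat, PowerSeries.order_eq_nat, hcoeff v le_rfl]
    exact and_congr_right fun _ => forall₂_congr fun j hj => by rw [hcoeff j hj.le]
  classical
  refine ⟨fun ⟨G, hG⟩ => ⟨_, (horder G).1 hG⟩, fun ⟨w, hw⟩ => ?_⟩
  let G : MvPowerSeries (Fin n) ℂ := fun e => if h : e ∈ T then w ⟨e, h⟩ else 0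
  have hG : ∀ e : T, MvPowerSeries.coeff (e : Fin n →₀ ℕ) G = w e := fun e => dif_pos e.2
  exact ⟨G, (horder G).2 (by simpa only [hG] using hw)⟩

theorem linearIndependent_of_injective_order {ι K : Type*} [Field K] {y : ι → K⟦X⟧}
    (hy0 : ∀ i, y i ≠ 0) (hy : Function.Injective fun i => (y i).order) :
    LinearIndependent K y := by
  classical
  rw [linearIndependent_iff']
  intro s c hc
  by_contra! hne
  obtain ⟨i, hi, hmin⟩ := (s.filter (c · ≠ 0)).exists_min_image (fun i => (y i).order)
    (Finset.filter_nonempty_iff.2 hne)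
  obtain ⟨his, hci⟩ := Finset.mem_filter.1 hi
  have hlt : ∀ j ∈ s, j ≠ i → c j * PowerSeries.coeff (y i).order.toNat (y j) = 0 := by
    intro j hj hji
    by_cases hcj : c j = 0
    · rw [hcj, zero_mul]
    · have hij : (y i).order < (y j).order :=
        (hmin j (Finset.mem_filter.2 ⟨hj, hcj⟩)).lt_of_ne (hy.ne hji.symm)
      rw [PowerSeries.coeff_of_lt_order _ ((ENat.natCast_toNat_le_self _).trans_lt hij), mul_zero]
  have hcoeff := congrArg (PowerSeries.coeff (y i).order.toNat) hc
  simp only [map_sum, PowerSeries.coeff_smul, smul_eq_mul, map_zero] at hcoeff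
  rw [Finset.sum_eq_single_of_mem i his hlt] at hcoeff
  exact (mul_ne_zero hci (PowerSeries.coeff_order (hy0 i))) hcoeff

theorem mul_succ_le_ncard_compl_add_choose {κ : ℕ} (hκ : κ ≠ 0) (hf : ∀ i, κ ≤ (f i).order)
    (hfin : (valueSemigroup f)ᶜ.Finite) (r : ℕ) :
    κ * (r + 1) ≤ (valueSemigroup f)ᶜ.ncard + (r + n).choose n := by
  classical
  have hf0 : ∀ i, (f i).constantCoeff = 0 := fun i =>
    PowerSeries.one_le_order_iff_constCoeff_eq_zero.1
      ((Nat.one_le_cast.2 (Nat.one_le_iff_ne_zero.2 hκ)).trans (hf i))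
  let s := (Finset.range (κ * (r + 1))).filter (· ∈ valueSemigroup f)
  have hy : ∀ v : s, ∃ y ∈ Submodule.span ℂ
      (((exponents n r).image (monomialSeries f) : Finset ℂ⟦X⟧) : Set ℂ⟦X⟧), y.order = v := by
    rintro ⟨v, hv⟩
    obtain ⟨hvr, hv⟩ := Finset.mem_filter.1 hv
    obtain ⟨w, hw⟩ := (mem_valueSemigroup_iff_exists_sum hf0 fun e he =>
      lt_order_monomialSeries hf he (Finset.mem_range.1 hvr)).1 hv
    exact ⟨_, Submodule.sum_mem _ fun e _ => Submodule.smul_mem _ _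
      (Submodule.subset_span (Finset.mem_coe.2 (Finset.mem_image_of_mem _ e.2))), hw⟩
  choose y hyT hyv using hy
  have hli : LinearIndependent ℂ y := linearIndependent_of_injective_order
    (fun v hv => by simpa [hv] using hyv v)
    fun v w hvw => Subtype.ext (Nat.cast_injective ((hyv v).symm.trans (hvw.trans (hyv w))))
  have hs : s.card ≤ (r + n).choose n := calc
    s.card = Fintype.card s := (Fintype.card_coe s).symm
    _ ≤ _ := linearIndependent_le_span_aux' y hli _ (Set.range_subset_iff.2 hyT)
    _ = ((exponents n r).image (monomialSeries f)).card := Fintype.card_coe _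
    _ ≤ _ := Finset.card_image_le.trans (card_exponents_le n r)
  calc κ * (r + 1) = (Finset.range (κ * (r + 1))).card := (Finset.card_range _).symm
    _ = s.card + ((Finset.range (κ * (r + 1))).filter (· ∉ valueSemigroup f)).card :=
      (Finset.card_filter_add_card_filter_not _).symm
    _ ≤ (r + n).choose n + (valueSemigroup f)ᶜ.ncard :=
      add_le_add hs ((Set.ncard_coe_finset _).symm.trans_le
        (Set.ncard_le_ncard (fun v hv => (Finset.mem_filter.1 hv).2) hfin))
    _ = _ := add_comm _ _

end Monomials

section Fredholm

variable {ι κ : Type*} [Fintype ι]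

theorem exists_vecMul_eq_zero_or_exists_mulVec_eq [Fintype κ] {K : Type*} [Field K]
    (A : Matrix ι κ K) (b : ι → K) : (∃ x, x ᵥ* A = 0 ∧ x ⬝ᵥ b ≠ 0) ∨ ∃ y, A *ᵥ y = b := by
  classical
  refine or_iff_not_imp_right.2 fun hb => ?_
  obtain ⟨φ, hφb, hφ⟩ := Submodule.exists_le_ker_of_notMem (p := A.mulVecLin.range) (v := b) hb
  obtain ⟨x, rfl⟩ := (dotProductEquiv K ι).surjective φ
  refine ⟨x, funext fun j => ?_, hφb⟩
  rw [← dotProduct_single_one (x ᵥ* A) j, ← Matrix.dotProduct_mulVec]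
  exact hφ (LinearMap.mem_range_self A.mulVecLin _)

theorem exists_vecMul_eq_zero_or_exists_mulVec_eq_smul [Fintype κ] {R : Type*} [CommRing R]
    [IsDomain R] (A : Matrix ι κ R) (b : ι → R) :
    (∃ x, x ᵥ* A = 0 ∧ x ⬝ᵥ b ≠ 0) ∨ ∃ D : R, D ≠ 0 ∧ ∃ y, A *ᵥ y = D • b := by
  let φ := algebraMap R (FractionRing R)
  have hφ : Function.Injective φ := IsFractionRing.injective R (FractionRing R)
  refine (exists_vecMul_eq_zero_or_exists_mulVec_eq (A.map φ) (φ ∘ b)).imp ?_ ?_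
  · rintro ⟨x, hxA, hxb⟩
    obtain ⟨D, hD⟩ := IsLocalization.exist_integer_multiples_of_finite (nonZeroDivisors R) x
    choose x' hx' using hD
    replace hx' : φ ∘ x' = φ D • x := funext fun i => (hx' i).trans (Algebra.smul_def _ _)
    refine ⟨x', funext fun j => hφ ?_, fun h => ?_⟩
    · rw [RingHom.map_vecMul, hx', Matrix.smul_vecMul, hxA, smul_zero, Pi.zero_apply,
        Pi.zero_apply, map_zero]
    · have hDx : φ D * (x ⬝ᵥ (φ ∘ b)) = 0 := by
        rw [← smul_eq_mul, ← smul_dotProduct, ← hx', ← RingHom.map_dotProduct, h, map_zero]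
      exact mul_ne_zero (hφ.ne_iff' (map_zero φ) |>.2 (nonZeroDivisors.coe_ne_zero D)) hxb hDx
  · rintro ⟨y, hy⟩
    obtain ⟨D, hD⟩ := IsLocalization.exist_integer_multiples_of_finite (nonZeroDivisors R) y
    choose y' hy' using hD
    replace hy' : φ ∘ y' = φ D • y := funext fun i => (hy' i).trans (Algebra.smul_def _ _)
    refine ⟨D, nonZeroDivisors.coe_ne_zero D, y', funext fun i => hφ ?_⟩
    rw [RingHom.map_mulVec, hy', Matrix.mulVec_smul, hy]
    simp

/-- By the Fredholm alternative, unsolvability of a linear system is witnessed by a polynomial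
identity, so generic solvability is decided over the ring of polynomials. -/
theorem eventually_exists_vecMul_eq_zero_or_eventually_not [Finite κ] {σ K : Type*}
    [Field K] (A : Matrix ι κ (MvPolynomial σ K)) (b : ι → MvPolynomial σ K) :
    (∀ᶠ x in generic σ K, ∃ w, w ᵥ* A.map (eval x) = 0 ∧ w ⬝ᵥ (eval x ∘ b) ≠ 0) ∨
      ∀ᶠ x in generic σ K, ¬∃ w, w ᵥ* A.map (eval x) = 0 ∧ w ⬝ᵥ (eval x ∘ b) ≠ 0 := by
  cases nonempty_fintype κ
  refine (exists_vecMul_eq_zero_or_exists_mulVec_eq_smul A b).imp ?_ ?_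
  · rintro ⟨w, hwA, hwb⟩
    filter_upwards [eventually_eval_ne_zero hwb] with x hx
    refine ⟨eval x ∘ w, funext fun j => ?_, by rwa [← RingHom.map_dotProduct]⟩
    rw [← RingHom.map_vecMul, hwA, Pi.zero_apply, Pi.zero_apply, map_zero]
  · rintro ⟨D, hD, y, hy⟩
    filter_upwards [eventually_eval_ne_zero hD] with x hx
    rintro ⟨w, hwA, hwb⟩
    have hy_eval : A.map (eval x) *ᵥ (eval x ∘ y) = eval x D • (eval x ∘ b) := by
      funext i
      rw [← RingHom.map_mulVec, hy]
      simp
    refine mul_ne_zero hx hwb ?_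
    rw [← smul_eq_mul, ← dotProduct_smul, ← hy_eval, Matrix.dotProduct_mulVec, hwA,
      zero_dotProduct]

end Fredholm

section GenericSemigroup

variable {n : ℕ} {R S : Type*} [CommRing R] [CommRing S]

/-- The power series `t ^ kᵢ * aᵢ(t)`, where `a (i, j)` is the coefficient of `t ^ j` in `aᵢ`. -/
def paramSeries (k : Fin n → ℕ) (a : Fin n × ℕ → R) (i : Fin n) : R⟦X⟧ :=
  PowerSeries.X ^ k i * PowerSeries.mk fun j => a (i, j)

theorem map_paramSeries (φ : R →+* S) (k : Fin n → ℕ) (a : Fin n × ℕ → R) (i : Fin n) :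
    (paramSeries k a i).map φ = paramSeries k (φ ∘ a) i := by
  simp only [paramSeries, map_mul, map_pow, PowerSeries.map_X]
  rfl

theorem map_monomialSeries (φ : R →+* S) (f : Fin n → R⟦X⟧) (e : Fin n →₀ ℕ) :
    (monomialSeries f e).map φ = monomialSeries (fun i => (f i).map φ) e := by
  simp only [monomialSeries, map_finsuppProd, map_pow]

theorem le_order_paramSeries (k : Fin n → ℕ) (a : Fin n × ℕ → R) (i : Fin n) :
    k i ≤ (paramSeries k a i).order :=
  PowerSeries.nat_le_order _ _ (PowerSeries.X_pow_dvd_iff.1 (dvd_mul_right _ _))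

theorem constantCoeff_paramSeries {k : Fin n → ℕ} (hk : ∀ i, k i ≠ 0) (a : Fin n × ℕ → R)
    (i : Fin n) : (paramSeries k a i).constantCoeff = 0 := by
  simp [paramSeries, hk i]

theorem isGenericValueSemigroup_iff {k : Fin n → ℕ} {S : Set ℕ} :
    IsGenericValueSemigroup k S ↔
      ∀ᶠ a in generic (Fin n × ℕ) ℂ, valueSemigroup (paramSeries k a) = S := by
  constructor
  · rintro ⟨Φ, hΦ, h⟩
    filter_upwards [eventually_eval_ne_zero hΦ,
      eventually_all.2 fun i => eventually_coord_ne_zero (i, 0)] with a haΦ ha0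
    exact h (fun i => PowerSeries.mk fun j => a (i, j)) (by simpa using ha0)
      (by simpa only [PowerSeries.coeff_mk] using haΦ)
  · rintro ⟨Φ, hΦ, h⟩
    refine ⟨Φ, hΦ, fun a _ ha => ?_⟩
    rw [← h _ ha]
    congr 1
    funext i
    rw [paramSeries]
    congr 1
    ext j
    rw [PowerSeries.coeff_mk]

theorem IsGenericValueSemigroup.unique {k : Fin n → ℕ} {S S' : Set ℕ}
    (h : IsGenericValueSemigroup k S) (h' : IsGenericValueSemigroup k S') : S = S' := by
  obtain ⟨a, ha, ha'⟩ :=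
    ((isGenericValueSemigroup_iff.1 h).and (isGenericValueSemigroup_iff.1 h')).exists
  exact ha.symm.trans ha'

variable {k : Fin n → ℕ}

theorem mem_valueSemigroup_paramSeries_iff (hk : ∀ i, k i ≠ 0) (a : Fin n × ℕ → ℂ) (v : ℕ) :
    v ∈ valueSemigroup (paramSeries k a) ↔ ∃ w : exponents n v → ℂ,
      w ᵥ* Matrix.of (fun e (j : Fin v) =>
        PowerSeries.coeff j (monomialSeries (paramSeries k a) e)) = 0 ∧
      w ⬝ᵥ (fun e => PowerSeries.coeff v (monomialSeries (paramSeries k a) e)) ≠ 0 := by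
  rw [mem_valueSemigroup_iff_exists_sum (constantCoeff_paramSeries hk a) fun e he =>
    lt_order_monomialSeries (κ := 1) (fun i =>
      (Nat.cast_le.2 (Nat.one_le_iff_ne_zero.2 (hk i))).trans (le_order_paramSeries k a i)) he
      (by rw [one_mul]; exact Nat.lt_succ_self v)]
  refine exists_congr fun w => ?_
  simp only [PowerSeries.order_eq_nat, map_sum, map_smul, smul_eq_mul, funext_iff, Fin.forall_iff,
    Matrix.vecMul, dotProduct, Matrix.of_apply, Pi.zero_apply, and_comm]

theorem eventually_mem_or_eventually_notMem (hk : ∀ i, k i ≠ 0) (v : ℕ) :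
    (∀ᶠ a in generic (Fin n × ℕ) ℂ, v ∈ valueSemigroup (paramSeries k a)) ∨
      ∀ᶠ a in generic (Fin n × ℕ) ℂ, v ∉ valueSemigroup (paramSeries k a) := by
  let F := paramSeries (R := MvPolynomial (Fin n × ℕ) ℂ) k MvPolynomial.X
  have hF : ∀ (a : Fin n × ℕ → ℂ) e j, eval a (PowerSeries.coeff j (monomialSeries F e)) =
      PowerSeries.coeff j (monomialSeries (paramSeries k a) e) := by
    intro a e j
    have hX : eval a ∘ MvPolynomial.X = a := funext fun s => MvPolynomial.eval_X s
    rw [← PowerSeries.coeff_map, map_monomialSeries]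
    simp only [F, map_paramSeries, hX]
  have h := eventually_exists_vecMul_eq_zero_or_eventually_not
    (Matrix.of fun (e : exponents n v) (j : Fin v) => PowerSeries.coeff j (monomialSeries F e))
    (fun e => PowerSeries.coeff v (monomialSeries F e))
  simp only [mem_valueSemigroup_paramSeries_iff hk, ← hF]
  exact h

theorem exists_isGenericValueSemigroup (hk : ∀ i, k i ≠ 0) {s : Set ℕ} (hgcd : Nat.setGcd s = 1)
    (hs : ∀ᶠ a in generic (Fin n × ℕ) ℂ, s ⊆ valueSemigroup (paramSeries k a)) :
    ∃ S, IsGenericValueSemigroup k S ∧ Sᶜ.Finite := by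
  obtain ⟨N, hN⟩ := Nat.exists_mem_closure_of_ge s
  have hlarge : ∀ v, N ≤ v → ∀ a, s ⊆ valueSemigroup (paramSeries k a) →
      v ∈ valueSemigroup (paramSeries k a) := fun v hv a ha =>
    (AddSubmonoid.closure_le (S := valueSubmonoid (constantCoeff_paramSeries hk a))).2 ha
      (hN v hv (hgcd ▸ one_dvd v))
  let S := {v | ∀ᶠ a in generic (Fin n × ℕ) ℂ, v ∈ valueSemigroup (paramSeries k a)}
  have hS : ∀ v, ∀ᶠ a in generic (Fin n × ℕ) ℂ, v ∈ valueSemigroup (paramSeries k a) ↔ v ∈ S := by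
    intro v
    by_cases hv : v ∈ S
    · exact Eventually.mono hv fun a ha => iff_of_true ha hv
    · exact ((eventually_mem_or_eventually_notMem hk v).resolve_left hv).mono fun a ha =>
        iff_of_false ha hv
  refine ⟨S, isGenericValueSemigroup_iff.2 ?_, (Set.finite_lt_nat N).subset fun v hv => ?_⟩
  · filter_upwards [hs, (Finset.range N).eventually_all.2 fun v _ => hS v] with a ha hsmall
    ext v
    rcases lt_or_ge v N with hv | hv
    · exact hsmall v (Finset.mem_range.2 hv)
    · exact iff_of_true (hlarge v hv a ha) (hs.mono fun a' => hlarge v hv a')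
  · exact not_le.1 fun hle => hv (hs.mono fun a => hlarge v hle a)

theorem eventually_mem_valueSemigroup (hk : ∀ i, k i ≠ 0) (i : Fin n) :
    ∀ᶠ a in generic (Fin n × ℕ) ℂ, k i ∈ valueSemigroup (paramSeries k a) := by
  filter_upwards [eventually_coord_ne_zero (i, 0)] with a ha
  refine (mem_valueSemigroup_iff (constantCoeff_paramSeries hk a)).2
    ⟨_, self_mem_branchRing _ i, ?_⟩
  rw [paramSeries, PowerSeries.order_mul, PowerSeries.order_X_pow,
    PowerSeries.order_zero_of_unit, add_zero]
  rw [PowerSeries.isUnit_iff_constantCoeff]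
  simpa using ha

/-- If `k i₀ + k i₂ = 2 k i₁`, then a suitable combination of `f i₁ ^ 2` and `f i₀ * f i₂` cancels
the leading terms, and generically nothing more. -/
theorem eventually_succ_mem_valueSemigroup (hk : ∀ i, k i ≠ 0) {i₀ i₁ i₂ : Fin n}
    (h₀ : i₀ ≠ i₁) (h₂ : i₂ ≠ i₁) (h : k i₀ + k i₂ = 2 * k i₁) :
    ∀ᶠ a in generic (Fin n × ℕ) ℂ, 2 * k i₁ + 1 ∈ valueSemigroup (paramSeries k a) := by
  let x (i : Fin n) (j : ℕ) : MvPolynomial (Fin n × ℕ) ℂ := MvPolynomial.X (i, j)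
  let Ψ := x i₀ 0 * x i₂ 0 * (2 * x i₁ 0 * x i₁ 1)
    - x i₁ 0 ^ 2 * (x i₀ 0 * x i₂ 1 + x i₀ 1 * x i₂ 0)
  have hΨ : eval (fun s => if s.2 = 0 ∨ s = (i₁, 1) then 1 else 0) Ψ ≠ 0 := by
    simp [Ψ, x, h₀, h₂]
  filter_upwards [eventually_eval_ne_zero_of_eval_ne_zero hΨ] with a ha
  let u i : ℂ⟦X⟧ := PowerSeries.mk fun j => a (i, j)
  let y := PowerSeries.C (a (i₀, 0) * a (i₂, 0)) * u i₁ ^ 2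
    - PowerSeries.C (a (i₁, 0) ^ 2) * (u i₀ * u i₂)
  have hy : y.order = (1 : ℕ) := by
    refine PowerSeries.order_eq_nat.2 ⟨?_, fun j hj => ?_⟩
    · convert ha using 1
      simp [y, u, Ψ, x, PowerSeries.coeff_one_mul, sq]
      ring
    · rw [Nat.lt_one_iff.1 hj]
      simp [y, u]
      ring
  have hf := constantCoeff_paramSeries hk a
  refine (mem_valueSemigroup_iff hf).2
    ⟨PowerSeries.C (a (i₀, 0) * a (i₂, 0)) * paramSeries k a i₁ ^ 2 -
      PowerSeries.C (a (i₁, 0) ^ 2) * (paramSeries k a i₀ * paramSeries k a i₂),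
      sub_mem (mul_mem (C_mem_branchRing hf _) (pow_mem (self_mem_branchRing hf i₁) 2))
        (mul_mem (C_mem_branchRing hf _)
          (mul_mem (self_mem_branchRing hf i₀) (self_mem_branchRing hf i₂))), ?_⟩
  have hy_mul : PowerSeries.C (a (i₀, 0) * a (i₂, 0)) * paramSeries k a i₁ ^ 2 -
      PowerSeries.C (a (i₁, 0) ^ 2) * (paramSeries k a i₀ * paramSeries k a i₂) =
        PowerSeries.X ^ (2 * k i₁) * y := by
    have hX : (PowerSeries.X ^ k i₁ : ℂ⟦X⟧) ^ 2 = PowerSeries.X ^ k i₀ * PowerSeries.X ^ k i₂ := by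
      rw [← pow_mul, ← pow_add, h, mul_comm]
    simp only [y, u, paramSeries]
    linear_combination (PowerSeries.C (a (i₁, 0) ^ 2) * u i₀ * u i₂) * hX
  rw [hy_mul, PowerSeries.order_mul, PowerSeries.order_X_pow, hy, Nat.cast_add]

end GenericSemigroup

section Action

variable {ι κ R S : Type*} [Fintype ι] [CommRing R] [CommRing S]

/-- The action of square matrices on tuples of forms, the forms being the rows of `c`. -/
def act (A : Matrix ι ι R) (c : ι × κ → R) : ι × κ → R :=
  fun s => ∑ l, A s.1 l * c (l, s.2)

theorem act_one [DecidableEq ι] (c : ι × κ → R) : act 1 c = c :=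
  funext fun s => congrFun₂ (Matrix.one_mul (Matrix.of (Function.curry c))) s.1 s.2

theorem act_act (A B : Matrix ι ι R) (c : ι × κ → R) : act A (act B c) = act (A * B) c :=
  funext fun s => (congrFun₂ (Matrix.mul_assoc A B (Matrix.of (Function.curry c))) s.1 s.2).symm

theorem map_act (φ : R →+* S) (A : Matrix ι ι R) (c : ι × κ → R) :
    φ ∘ act A c = act (A.map φ) (φ ∘ c) := by
  funext s
  simp only [act, Function.comp_apply, map_sum, map_mul, Matrix.map_apply]

end Action

section Projective

variable {n d : ℕ}

/-- The expansion of the binary form `s ^ j u ^ (d - j)` at `p`. -/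
def monomialExpansion (d : ℕ) (p : OnePoint ℂ) (j : Fin (d + 1)) : ℂ⟦X⟧ :=
  p.elim (PowerSeries.X ^ (d - (j : ℕ))) fun z => (PowerSeries.C z + PowerSeries.X) ^ (j : ℕ)

theorem expansion_eq_sum (c : Forms n d) (p : OnePoint ℂ) (i : Fin (n + 1)) :
    expansion c p i = ∑ j, PowerSeries.C (c (i, j)) * monomialExpansion d p j := by
  cases p <;> rfl

theorem expansion_act (A : Matrix (Fin (n + 1)) (Fin (n + 1)) ℂ) (c : Forms n d)
    (p : OnePoint ℂ) (i : Fin (n + 1)) :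
    expansion (act A c) p i = ∑ l, PowerSeries.C (A i l) * expansion c p l := by
  simp only [expansion_eq_sum, act, map_sum, map_mul, Finset.mul_sum, Finset.sum_mul,
    mul_assoc]
  exact Finset.sum_comm

theorem value_act (A : Matrix (Fin (n + 1)) (Fin (n + 1)) ℂ) (c : Forms n d) (p : OnePoint ℂ) :
    value (act A c) p = A *ᵥ value c p := by
  funext i
  simp [value, expansion_act, Matrix.mulVec, dotProduct]

theorem constantCoeff_germ (c : Forms n d) (p : OnePoint ℂ) (j : Fin (n + 1)) (i : Fin n) :
    (germ c p j i).constantCoeff = 0 := by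
  simp [germ, value]

variable {c : Forms n d} {p : OnePoint ℂ} {j : Fin (n + 1)}

theorem expansion_mul_inv_mem_branchRing (hj : value c p j ≠ 0) (i : Fin (n + 1)) :
    expansion c p i * (expansion c p j)⁻¹ ∈ branchRing (constantCoeff_germ c p j) := by
  rcases Fin.eq_self_or_eq_succAbove j i with rfl | ⟨i, rfl⟩
  · rw [PowerSeries.mul_inv_cancel _ hj]
    exact one_mem _
  · rw [← sub_add_cancel (_ * _) (PowerSeries.C (value c p (j.succAbove i) * (value c p j)⁻¹))]
    exact add_mem (self_mem_branchRing (constantCoeff_germ c p j) i) (C_mem_branchRing _ _)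

theorem expansion_act_mul_inv_mem_branchRing (hj : value c p j ≠ 0)
    (A : Matrix (Fin (n + 1)) (Fin (n + 1)) ℂ) (i : Fin (n + 1)) :
    expansion (act A c) p i * (expansion c p j)⁻¹ ∈ branchRing (constantCoeff_germ c p j) := by
  rw [expansion_act, Finset.sum_mul]
  refine sum_mem fun l _ => ?_
  rw [mul_assoc]
  exact mul_mem (C_mem_branchRing _ _) (expansion_mul_inv_mem_branchRing hj l)

theorem valueSemigroup_germ_act_subset (A : Matrix (Fin (n + 1)) (Fin (n + 1)) ℂ)
    {j' : Fin (n + 1)} (hj : value c p j ≠ 0) (hj' : value (act A c) p j' ≠ 0) :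
    valueSemigroup (germ (act A c) p j') ⊆ valueSemigroup (germ c p j) := by
  refine valueSemigroup_subset (constantCoeff_germ c p j) (constantCoeff_germ _ p j') fun i => ?_
  set E := expansion c p j
  set E' := expansion (act A c) p j'
  have hE' : E' * E'⁻¹ = 1 := PowerSeries.mul_inv_cancel _ hj'
  have hunit : (E' * E⁻¹).constantCoeff ≠ 0 := by
    rw [map_mul, PowerSeries.constantCoeff_inv]
    exact mul_ne_zero hj' (inv_ne_zero hj)
  have hquot : expansion (act A c) p (j'.succAbove i) * E'⁻¹ =
      expansion (act A c) p (j'.succAbove i) * E⁻¹ * (E' * E⁻¹)⁻¹ := by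
    rw [PowerSeries.eq_mul_inv_iff_mul_eq hunit]
    linear_combination (expansion (act A c) p (j'.succAbove i) * E⁻¹) * hE'
  rw [germ, hquot]
  exact sub_mem (mul_mem (expansion_act_mul_inv_mem_branchRing hj A _)
    (inv_mem_branchRing _ (expansion_act_mul_inv_mem_branchRing hj A _) hunit))
    (C_mem_branchRing _ _)

theorem valueSemigroupAt_eq (hj : value c p j ≠ 0) :
    valueSemigroupAt c p = valueSemigroup (germ c p j) := by
  ext v
  refine ⟨fun ⟨j', hj', hv⟩ => ?_, fun hv => ⟨j, hj, hv⟩⟩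
  rw [← act_one c] at hv hj'
  exact valueSemigroup_germ_act_subset 1 hj hj' hv

theorem valueSemigroupAt_act_subset (A : Matrix (Fin (n + 1)) (Fin (n + 1)) ℂ)
    (hc : value c p ≠ 0) : valueSemigroupAt (act A c) p ⊆ valueSemigroupAt c p := by
  obtain ⟨j, hj⟩ := Function.ne_iff.1 hc
  rintro v ⟨j', hj', hv⟩
  exact ⟨j, hj, valueSemigroup_germ_act_subset A hj hj' hv⟩

theorem act_inv_act (A : GL (Fin (n + 1)) ℂ) (c : Forms n d) :
    act (A⁻¹ : GL (Fin (n + 1)) ℂ).1 (act A.1 c) = c := by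
  rw [act_act, Units.inv_mul, act_one]

theorem act_mem_maps (A : GL (Fin (n + 1)) ℂ) (hc : c ∈ maps n d) : act A.1 c ∈ maps n d := by
  refine ⟨fun p h => hc.1 p ?_, ?_⟩
  · rw [← act_inv_act A c, value_act, h, Matrix.mulVec_zero]
  · have hrows : Function.Injective (· ᵥ* Matrix.of (Function.curry c)) :=
      Matrix.vecMul_injective_iff.2 hc.2
    have hA : Function.Injective (· ᵥ* A.1) := Matrix.vecMul_injective_of_isUnit A.isUnit
    refine Matrix.vecMul_injective_iff (M := A.1 * Matrix.of (Function.curry c)).1 fun x y hxy => ?_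
    simp only [← Matrix.vecMul_vecMul] at hxy
    exact hA (hrows hxy)

theorem valueSemigroupAt_act (A : GL (Fin (n + 1)) ℂ) (hc : c ∈ maps n d) :
    valueSemigroupAt (act A.1 c) = valueSemigroupAt c := by
  funext p
  refine (valueSemigroupAt_act_subset A.1 (hc.1 p)).antisymm ?_
  simpa only [act_inv_act] using
    valueSemigroupAt_act_subset (A⁻¹ : GL (Fin (n + 1)) ℂ).1 ((act_mem_maps A hc).1 p)

theorem act_mem_severi {g : ℕ} {S : Set ℕ} (A : GL (Fin (n + 1)) ℂ) (hc : c ∈ severi n d g S) :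
    act A.1 c ∈ severi n d g S := by
  obtain ⟨hM, hinj, hg, hcusp⟩ := hc
  have hv := valueSemigroupAt_act A hM
  refine ⟨act_mem_maps A hM, fun q q' h => hinj ?_, by rwa [arithGenus, hv], by rwa [hv]⟩
  rw [toMap, toMap, Projectivization.mk_eq_mk_iff'] at h ⊢
  obtain ⟨a, ha⟩ := h
  refine ⟨a, ?_⟩
  rw [← act_inv_act A c, value_act, ← Matrix.mulVec_smul, ha, ← value_act]

end Projective

section Codimension

theorem height_map_quotient_le {R : Type*} [CommRing R] {I J P : Ideal R} [P.IsPrime]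
    (hJ : J ≤ P) (hI : I ≤ P) : (I.map (Ideal.Quotient.mk J)).height ≤ P.height := by
  have hsurj : Function.Surjective (Ideal.Quotient.mk J) := Ideal.Quotient.mk_surjective
  have hker : RingHom.ker (Ideal.Quotient.mk J) ≤ P := by rwa [Ideal.mk_ker]
  have hprime : (P.map (Ideal.Quotient.mk J)).IsPrime := Ideal.map_isPrime_of_surjective hsurj hker
  have hcomap : (P.map (Ideal.Quotient.mk J)).comap (Ideal.Quotient.mk J) = P := by
    rw [Ideal.comap_map_of_surjective' _ hsurj, sup_eq_left.2 hker]
  have hmono : StrictMono (PrimeSpectrum.comap (Ideal.Quotient.mk J)) :=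
    Monotone.strictMono_of_injective (fun _ _ h => Ideal.comap_mono h)
      (PrimeSpectrum.comap_injective_of_surjective _ hsurj)
  have h := Order.height_le_height_apply_of_strictMono _ hmono
    ⟨P.map (Ideal.Quotient.mk J), hprime⟩
  rw [show PrimeSpectrum.comap (Ideal.Quotient.mk J) ⟨_, hprime⟩ = ⟨P, inferInstance⟩ from
    PrimeSpectrum.ext hcomap, ← PrimeSpectrum.height_eq_orderHeight,
    ← PrimeSpectrum.height_eq_orderHeight] at h
  exact (Ideal.height_mono (Ideal.map_mono hI)).trans h

variable {σ : Type*} {V M : Set (σ → ℂ)}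

theorem codim_le_height (hVM : V ⊆ M) {P : Ideal (MvPolynomial σ ℂ)} [P.IsPrime]
    (hV : MvPolynomial.vanishingIdeal ℂ V ≤ P) : codim V M ≤ P.height :=
  height_map_quotient_le ((MvPolynomial.vanishingIdeal_anti_mono hVM).trans hV) hV

theorem mem_radical_span_iff [Finite σ] {E : Finset (MvPolynomial σ ℂ)}
    {h : MvPolynomial σ ℂ} :
    h ∈ (Ideal.span (E : Set (MvPolynomial σ ℂ))).radical ↔
      ∀ x, (∀ e ∈ E, eval x e = 0) → eval x h = 0 := by
  rw [← MvPolynomial.vanishingIdeal_zeroLocus_eq_radical (K := ℂ), MvPolynomial.zeroLocus_span]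
  simp [MvPolynomial.mem_vanishingIdeal_iff, MvPolynomial.aeval_eq_eval]

theorem codim_le_card [Finite σ] (hVM : V ⊆ M) (E : Finset (MvPolynomial σ ℂ))
    (Δ : MvPolynomial σ ℂ) {x₀ : σ → ℂ} (hE : ∀ e ∈ E, eval x₀ e = 0) (hΔ : eval x₀ Δ ≠ 0)
    (hdense : ∀ x, (∀ e ∈ E, eval x e = 0) → eval x Δ ≠ 0 →
      x ∈ MvPolynomial.zeroLocus ℂ (MvPolynomial.vanishingIdeal ℂ V)) :
    codim V M ≤ E.card := by
  set I : Ideal (MvPolynomial σ ℂ) := Ideal.span (E : Set (MvPolynomial σ ℂ))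
  obtain ⟨P, hP, hΔP⟩ : ∃ P ∈ I.minimalPrimes, Δ ∉ P := by
    have h : Δ ∉ sInf I.minimalPrimes := by
      rw [Ideal.sInf_minimalPrimes, mem_radical_span_iff]
      exact fun h => hΔ (h x₀ hE)
    simpa only [Submodule.mem_sInf, not_forall, exists_prop] using h
  have hprime : P.IsPrime := hP.1.1
  refine (codim_le_height (P := P) hVM fun h hh => ?_).trans
    (Ideal.height_le_card_of_mem_minimalPrimes_span_finset hP)
  have hmul : h * Δ ∈ I.radical := by
    refine mem_radical_span_iff.2 fun x hx => ?_
    rw [map_mul]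
    by_cases hx0 : eval x Δ = 0
    · rw [hx0, mul_zero]
    · have := hdense x hx hx0 h hh
      rw [MvPolynomial.aeval_eq_eval] at this
      exact mul_eq_zero_of_left this _
  exact (hprime.mem_or_mem ((hprime.radical_le_iff.2 hP.1.2) hmul)).resolve_right hΔP

end Codimension

section Echelon

variable {n N : ℕ} {R S : Type*} [CommRing R] [CommRing S]

/-- The tuple of forms obtained from `x` by deleting the coefficients of the `i`-th form before
column `k i`. -/
def mask {ι : Type*} (k : ι → ℕ) (x : ι × Fin N → R) : ι × Fin N → R :=
  Set.indicator {s | k s.1 ≤ s.2} x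

theorem mask_of_lt {ι : Type*} {k : ι → ℕ} {i : ι} {j : Fin N} (h : j < k i)
    (x : ι × Fin N → R) : mask k x (i, j) = 0 :=
  Set.indicator_of_notMem (s := {s : ι × Fin N | k s.1 ≤ s.2}) (not_le.2 h) x

theorem mask_of_le {ι : Type*} {k : ι → ℕ} {i : ι} {j : Fin N} (h : k i ≤ j)
    (x : ι × Fin N → R) : mask k x (i, j) = x (i, j) :=
  Set.indicator_of_mem (s := {s : ι × Fin N | k s.1 ≤ s.2}) h x

theorem eval_comp_X {σ : Type*} (x : σ → R) : eval x ∘ MvPolynomial.X = x :=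
  funext fun s => MvPolynomial.eval_X s

theorem map_mask {ι : Type*} (φ : R →+* S) (k : ι → ℕ) (x : ι × Fin N → R) :
    φ ∘ mask k x = mask k (φ ∘ x) :=
  (Set.indicator_comp_of_zero (map_zero φ)).symm

/-- The square block of the coefficients of the forms in the columns `k j`. -/
def pivotBlock (k : Fin n → Fin N) (c : Fin n × Fin N → R) : Matrix (Fin n) (Fin n) R :=
  Matrix.of fun i j => c (i, k j)

/-- The row-reduced tuple of forms, with denominators cleared: its coefficients in the columns
`k j` form a scalar matrix. -/
def reduced (k : Fin n → Fin N) (c : Fin n × Fin N → R) : Fin n × Fin N → R :=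
  act (pivotBlock k c).adjugate c

theorem map_pivotBlock (φ : R →+* S) (k : Fin n → Fin N) (c : Fin n × Fin N → R) :
    (pivotBlock k c).map φ = pivotBlock k (φ ∘ c) :=
  rfl

theorem map_reduced (φ : R →+* S) (k : Fin n → Fin N) (c : Fin n × Fin N → R) :
    φ ∘ reduced k c = reduced k (φ ∘ c) := by
  rw [reduced, map_act]
  exact congrArg (act · _) (φ.map_adjugate (pivotBlock k c))

theorem eval_reduced (k : Fin n → Fin N) (c : Fin n × Fin N → R) (s : Fin n × Fin N) :
    eval c (reduced k MvPolynomial.X s) = reduced k c s := by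
  rw [← Function.comp_apply (f := eval c), map_reduced, eval_comp_X]

theorem eval_det_pivotBlock (k : Fin n → Fin N) (c : Fin n × Fin N → R) :
    eval c (pivotBlock k MvPolynomial.X).det = (pivotBlock k c).det := by
  rw [RingHom.map_det, RingHom.mapMatrix_apply, map_pivotBlock, eval_comp_X]

theorem reduced_apply_pivot (k : Fin n → Fin N) (c : Fin n × Fin N → R) (i j : Fin n) :
    reduced k c (i, k j) = if i = j then (pivotBlock k c).det else 0 :=
  (congrFun₂ (Matrix.adjugate_mul (pivotBlock k c)) i j).trans (by
    simp [Matrix.smul_apply, Matrix.one_apply])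

theorem mask_reduced {k : Fin n → Fin N} {c : Fin n × Fin N → R}
    (h : ∀ i, ∀ l ∈ Finset.Iio (k i) \ (Finset.Iio i).image k, reduced k c (i, l) = 0) :
    mask (fun i => k i) (reduced k c) = reduced k c := by
  refine Set.indicator_eq_self.2 fun ⟨i, l⟩ => not_imp_comm.1 fun hil => ?_
  have hil : l < k i := lt_of_not_ge hil
  by_cases hl : l ∈ (Finset.Iio i).image k
  · obtain ⟨j, hj, rfl⟩ := Finset.mem_image.1 hl
    rw [reduced_apply_pivot, if_neg (Finset.mem_Iio.1 hj).ne']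
  · exact h i l (Finset.mem_sdiff.2 ⟨Finset.mem_Iio.2 hil, hl⟩)

theorem card_Iio_sdiff_image {k : Fin n → Fin N} (hk : StrictMono k) (i : Fin n) :
    (Finset.Iio (k i) \ (Finset.Iio i).image k).card = k i - i := by
  have hsub : (Finset.Iio i).image k ⊆ Finset.Iio (k i) := fun l hl => by
    obtain ⟨j, hj, rfl⟩ := Finset.mem_image.1 hl
    exact Finset.mem_Iio.2 (hk (Finset.mem_Iio.1 hj))
  rw [Finset.card_sdiff_of_subset hsub, Finset.card_image_of_injective _ hk.injective,
    Fin.card_Iio, Fin.card_Iio]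

/-- Equations that define, where the pivot block is invertible, the orbit under the action of
matrices of the tuples of forms fixed by `mask k`. -/
def echelonEquations (k : Fin n → Fin N) : Finset (MvPolynomial (Fin n × Fin N) ℂ) :=
  Finset.univ.biUnion fun i =>
    (Finset.Iio (k i) \ (Finset.Iio i).image k).image fun l => reduced k MvPolynomial.X (i, l)

theorem card_echelonEquations_le {k : Fin n → Fin N} (hk : StrictMono k) :
    (echelonEquations k).card ≤ ∑ i, ((k i : ℕ) - i) :=
  Finset.card_biUnion_le.trans <| Finset.sum_le_sum fun i _ =>
    Finset.card_image_le.trans (card_Iio_sdiff_image hk i).le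

theorem forall_mem_echelonEquations_iff {k : Fin n → Fin N} {c : Fin n × Fin N → ℂ} :
    (∀ e ∈ echelonEquations k, eval c e = 0) ↔
      ∀ i, ∀ l ∈ Finset.Iio (k i) \ (Finset.Iio i).image k, reduced k c (i, l) = 0 := by
  simp only [echelonEquations, Finset.mem_biUnion, Finset.mem_univ, true_and, Finset.mem_image,
    forall_exists_index, and_imp, forall_apply_eq_imp_iff₂, forall_comm (β := Fin n), eval_reduced]

theorem act_mem_zeroLocus_vanishingIdeal {k : Fin n → ℕ} {V : Set (Fin n × Fin N → ℂ)}
    (hV : ∀ A : GL (Fin n) ℂ, ∀ c ∈ V, act A.1 c ∈ V)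
    (hdense : ∃ᶠ x in generic (Fin n × Fin N) ℂ, mask k x ∈ V) (A : GL (Fin n) ℂ)
    (x : Fin n × Fin N → ℂ) :
    act A.1 (mask k x) ∈ MvPolynomial.zeroLocus ℂ (MvPolynomial.vanishingIdeal ℂ V) := by
  intro h hh
  let H : MvPolynomial (Fin n × Fin N) ℂ :=
    MvPolynomial.bind₁ (act (A.1.map MvPolynomial.C) (mask k MvPolynomial.X)) h
  have hH (x : Fin n × Fin N → ℂ) : eval x H = eval (act A.1 (mask k x)) h := by
    refine (MvPolynomial.eval₂Hom_bind₁ _ _ _ _).trans (congrArg (eval · h) ?_)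
    refine (map_act (eval x) _ _).trans ?_
    rw [map_mask, eval_comp_X]
    congr 1
    ext i j
    exact MvPolynomial.eval_C _
  have hH0 : H = 0 := eq_zero_of_frequently_eval_eq_zero <| hdense.mono fun x hx => by
    rw [hH, ← MvPolynomial.aeval_eq_eval]
    exact hh _ (hV A _ hx)
  rw [MvPolynomial.aeval_eq_eval]
  exact (hH x).symm.trans (by rw [hH0, map_zero])

theorem codim_le_of_frequently_mask_mem {k : Fin n → Fin N} (hk : StrictMono k)
    {V M : Set (Fin n × Fin N → ℂ)} (hVM : V ⊆ M)
    (hV : ∀ A : GL (Fin n) ℂ, ∀ c ∈ V, act A.1 c ∈ V)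
    (hdense : ∃ᶠ x in generic (Fin n × Fin N) ℂ, mask (fun i => k i) x ∈ V) :
    codim V M ≤ (∑ i, ((k i : ℕ) - i) : ℕ) := by
  let x₀ : Fin n × Fin N → ℂ := fun s => if k s.1 = s.2 then 1 else 0
  have hx₀ : pivotBlock k x₀ = 1 := by
    ext i j
    simp [pivotBlock, x₀, Matrix.one_apply, hk.injective.eq_iff]
  have hx₀' : reduced k x₀ = x₀ := by rw [reduced, hx₀, Matrix.adjugate_one, act_one]
  refine (codim_le_card hVM (echelonEquations k) (pivotBlock k MvPolynomial.X).det (x₀ := x₀)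
    (forall_mem_echelonEquations_iff.2 fun i l hl => ?_) ?_ fun c hc hΔ => ?_).trans
    (Nat.cast_le.2 (card_echelonEquations_le hk))
  · rw [hx₀']
    exact if_neg (Finset.mem_Iio.1 (Finset.mem_sdiff.1 hl).1).ne'
  · rw [eval_det_pivotBlock, hx₀, Matrix.det_one]
    exact one_ne_zero
  · rw [eval_det_pivotBlock] at hΔ
    have hunit : IsUnit (pivotBlock k c).adjugate :=
      (Matrix.isUnit_iff_isUnit_det _).2 (by
        rw [Matrix.det_adjugate]; exact (isUnit_iff_ne_zero.2 hΔ).pow _)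
    have h := act_mem_zeroLocus_vanishingIdeal hV hdense hunit.unit⁻¹ (reduced k c)
    rwa [mask_reduced (forall_mem_echelonEquations_iff.1 hc), reduced, act_act,
      hunit.val_inv_mul, act_one] at h

end Echelon

section GeneralPosition

theorem eventually_notMem_range {σ τ : Type*} [Fintype σ] [Fintype τ]
    (h : Fintype.card τ < Fintype.card σ) (p : σ → MvPolynomial τ ℂ) :
    ∀ᶠ x in generic σ ℂ, ∀ y, x ≠ fun s => eval y (p s) := by
  have hp : ¬ AlgebraicIndependent ℂ p := fun hp => by
    have := hp.lift_cardinalMk_le_trdeg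
    simp only [MvPolynomial.trdeg_of_isDomain, Cardinal.mk_fintype, Cardinal.lift_natCast,
      Nat.cast_le] at this
    omega
  obtain ⟨Ψ, hΨp, hΨ⟩ : ∃ Ψ, MvPolynomial.aeval p Ψ = 0 ∧ Ψ ≠ 0 := by
    simpa only [algebraicIndependent_iff, not_forall, exists_prop] using hp
  refine (eventually_eval_ne_zero hΨ).mono fun x hx y hxy => hx ?_
  rw [hxy]
  refine (MvPolynomial.eval₂Hom_bind₁ _ _ _ Ψ).symm.trans ?_
  rw [← MvPolynomial.aeval_eq_bind₁, hΨp, map_zero]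

theorem eventually_exists_sum_ne_zero {ι κ ρ : Type*} [Finite ι] [Fintype κ] [Fintype ρ]
    (I : Finset ι) (j₀ : κ) (hρ : Fintype.card ρ < I.card) {W : ι × κ → MvPolynomial ρ ℂ}
    (hW : ∀ i ∈ I, W (i, j₀) = 1) :
    ∀ᶠ x in generic (ι × κ) ℂ, ∀ y, ∃ i ∈ I, ∑ j, x (i, j) * eval y (W (i, j)) ≠ 0 := by
  classical
  have := Fintype.ofFinite ι
  let F : Finset (ι × κ) := I ×ˢ {j₀}
  have hF (s : ι × κ) : s ∈ F ↔ s.1 ∈ I ∧ s.2 = j₀ := by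
    rw [Finset.mem_product, Finset.mem_singleton]
  let p (s : ι × κ) : MvPolynomial (ρ ⊕ {s // s ∉ F}) ℂ :=
    if h : s ∈ F then
      -∑ j : {j // j ≠ j₀}, MvPolynomial.X (.inr ⟨(s.1, j), fun h => j.2 ((hF _).1 h).2⟩) *
        MvPolynomial.rename .inl (W (s.1, j))
    else MvPolynomial.X (.inr ⟨s, h⟩)
  have hcard : Fintype.card (ρ ⊕ {s // s ∉ F}) < Fintype.card (ι × κ) := by
    have hle := Finset.card_le_univ F
    rw [Fintype.card_sum, Fintype.card_subtype_compl, Fintype.card_coe]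
    simp only [F, Finset.card_product, Finset.card_singleton, mul_one] at hle ⊢
    omega
  refine (eventually_notMem_range hcard p).mono fun x hx y => ?_
  by_contra! hy
  refine hx (Sum.elim y fun s => x s.1) (funext fun s => ?_)
  by_cases hs : s ∈ F
  · obtain ⟨hi, hj⟩ := (hF s).1 hs
    have hsum := hy s.1 hi
    rw [Fintype.sum_eq_add_sum_subtype_ne _ j₀, hW _ hi, map_one, mul_one] at hsum
    simp only [p, dif_pos hs, map_neg, map_sum, map_mul, MvPolynomial.eval_X,
      MvPolynomial.eval_rename, Sum.elim_inr, Sum.elim_comp_inl]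
    rw [← Prod.mk.eta (p := s), hj]
    exact eq_neg_of_add_eq_zero_left hsum
  · simp [p, hs]

theorem eventually_isSolution_sum_ne_zero {n d r : ℕ} {k : Fin n → ℕ} {I : Finset (Fin n)}
    (hI : 2 * r ≤ I.card) (hk : ∀ i ∈ I, k i + r ≤ d + 1) (e : Fin r) :
    ∀ᶠ x in generic (Fin n × Fin (d + 1)) ℂ, ∀ (a : Fin r → ℂ) (u : ℕ → ℂ),
      (LinearRecurrence.mk r a).IsSolution u → u e = 1 →
        ∃ i ∈ I, ∑ j, mask k x (i, j) * u (d - j) ≠ 0 := by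
  classical
  let L : LinearRecurrence (MvPolynomial (Fin r ⊕ {s // s ≠ e}) ℂ) := ⟨r, fun i => .X (.inl i)⟩
  let U : ℕ → MvPolynomial (Fin r ⊕ {s // s ≠ e}) ℂ :=
    L.mkSol fun s => if h : s ≠ e then .X (.inr ⟨s, h⟩) else 1
  have hUe : U e = 1 := (L.mkSol_eq_init _ e).trans (dif_neg (not_not.2 rfl))
  have hρ : Fintype.card (Fin r ⊕ {s // s ≠ e}) < I.card := by
    have := e.pos
    simp only [ne_eq, Fintype.card_sum, Fintype.card_fin, Fintype.card_subtype_compl,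
      Fintype.card_unique]
    omega
  have hW (i) (hi : i ∈ I) : mask k (fun s => U (d - s.2)) (i, Fin.ofNat (d + 1) (d - e)) = 1 := by
    have h := hk i hi
    have he : (Fin.ofNat (d + 1) (d - e) : ℕ) = d - e := Nat.mod_eq_of_lt (by omega)
    refine (mask_of_le (by simp only [he]; omega) _).trans ?_
    rw [he, Nat.sub_sub_self (by omega), hUe]
  refine (eventually_exists_sum_ne_zero I _ hρ hW).mono fun x hx a u hu hue => ?_
  let y : Fin r ⊕ {s // s ≠ e} → ℂ := Sum.elim a fun s => u s.1
  have hU : u = fun l => eval y (U l) := by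
    rw [LinearRecurrence.eq_mk_of_is_sol_of_eq_init' _ hu (init := fun s => u s) fun _ => rfl]
    refine (LinearRecurrence.eq_mk_of_is_sol_of_eq_init' _ (fun l => ?_) fun s => ?_).symm
    · refine (congrArg (eval y) (L.is_sol_mkSol _ l)).trans ?_
      simp only [L, y, map_sum, map_mul, MvPolynomial.eval_X, Sum.elim_inl]
      rfl
    · refine (congrArg (eval y) (L.mkSol_eq_init _ s)).trans ?_
      dsimp only
      split_ifs with hs
      · exact MvPolynomial.eval_X _
      · rw [map_one, not_not.1 hs, hue]
  obtain ⟨i, hi, hne⟩ := hx y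
  refine ⟨i, hi, fun h0 => hne ((Finset.sum_congr rfl fun j _ => ?_).trans h0)⟩
  rw [hU, ← Function.comp_apply (f := eval y), map_mask]
  simp only [mask, Set.indicator]
  split_ifs <;> simp

/-- No nonzero solution `u` of a linear recurrence of order `r` is orthogonal to the rows `i ∈ I` of
`c`, read backwards. As the solutions are spanned by the sequences `l ↦ (l choose e) * w ^ (l - e)`,
with `e` less than the multiplicity of the root `w`, this says that the span of the forms `i ∈ I`
separates the effective divisors of degree `r` on `ℙ¹ ∖ {0}`, where `w⁻¹` is the coordinate. -/
def SeparatesDivisors {ι : Type*} {d : ℕ} (r : ℕ) (I : Finset ι)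
    (c : ι × Fin (d + 1) → ℂ) : Prop :=
  ∀ (a : Fin r → ℂ) (u : ℕ → ℂ), (LinearRecurrence.mk r a).IsSolution u →
    (∀ i ∈ I, ∑ j, c (i, j) * u (d - j) = 0) → u = 0

theorem eventually_separatesDivisors_mask {n d r : ℕ} {k : Fin n → ℕ} {I : Finset (Fin n)}
    (hI : 2 * r ≤ I.card) (hk : ∀ i ∈ I, k i + r ≤ d + 1) :
    ∀ᶠ x in generic (Fin n × Fin (d + 1)) ℂ, SeparatesDivisors r I (mask k x) := by
  refine (eventually_all.2 (eventually_isSolution_sum_ne_zero hI hk)).mono fun x hx a u hu h0 => ?_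
  let L : LinearRecurrence ℂ := ⟨r, a⟩
  have hinit (e : Fin r) : u e = 0 := by
    by_contra hue
    obtain ⟨i, hi, hne⟩ := hx e a ((u e)⁻¹ • u) (L.solSpace.smul_mem _ hu) (inv_mul_cancel₀ hue)
    refine hne ?_
    simp only [Pi.smul_apply, smul_eq_mul, mul_left_comm _ (u e)⁻¹, ← Finset.mul_sum, h0 i hi,
      mul_zero]
  exact (L.eq_mk_of_is_sol_of_eq_init' hu hinit).trans
    (L.eq_mk_of_is_sol_of_eq_init' L.solSpace.zero_mem fun _ => rfl).symm

end GeneralPosition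

section Immersion

variable {n d : ℕ} {c : Forms n d} {p q : OnePoint ℂ}

/-- The derivatives, at `p`, of the homogeneous coordinates of the morphism. -/
def slope (c : Forms n d) (p : OnePoint ℂ) : Fin (n + 1) → ℂ :=
  fun i => PowerSeries.coeff 1 (expansion c p i)

theorem value_eq_sum (c : Forms n d) (p : OnePoint ℂ) (i : Fin (n + 1)) :
    value c p i = ∑ j, c (i, j) * PowerSeries.constantCoeff (monomialExpansion d p j) := by
  simp only [value, expansion_eq_sum, map_sum, map_mul, PowerSeries.constantCoeff_C]

theorem slope_eq_sum (c : Forms n d) (p : OnePoint ℂ) (i : Fin (n + 1)) :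
    slope c p i = ∑ j, c (i, j) * PowerSeries.coeff 1 (monomialExpansion d p j) := by
  simp only [slope, expansion_eq_sum, map_sum, PowerSeries.coeff_C_mul]

theorem valueSemigroupAt_eq_univ (h : LinearIndependent ℂ ![value c p, slope c p]) :
    valueSemigroupAt c p = Set.univ := by
  have hv : value c p ≠ 0 := h.ne_zero 0
  obtain ⟨j, hj⟩ := Function.ne_iff.1 hv
  rw [valueSemigroupAt_eq hj]
  by_contra hne
  have hgerm (i) : PowerSeries.coeff 1 (germ c p j i) = 0 := by
    by_contra hi
    exact hne (valueSemigroup_eq_univ (constantCoeff_germ c p j) hi)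
  refine (LinearIndependent.pair_iff' hv).1 h (slope c p j / value c p j) (funext fun i => ?_)
  have hj : value c p j ≠ 0 := hj
  rcases Fin.eq_self_or_eq_succAbove j i with rfl | ⟨i, rfl⟩
  · exact div_mul_cancel₀ _ hj
  · have hE : (germ c p j i + PowerSeries.C (value c p (j.succAbove i) * (value c p j)⁻¹)) *
        expansion c p j = expansion c p (j.succAbove i) := by
      rw [germ, sub_add_cancel, mul_assoc, PowerSeries.inv_mul_cancel _ hj, mul_one]
    have hslope := congrArg (PowerSeries.coeff 1) hE
    rw [PowerSeries.coeff_one_mul, map_add, hgerm, PowerSeries.coeff_C, if_neg one_ne_zero,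
      add_zero, zero_mul, zero_add, map_add, constantCoeff_germ, zero_add,
      PowerSeries.constantCoeff_C] at hslope
    rw [Pi.smul_apply, smul_eq_mul, slope, slope, ← hslope]
    ring

/-- The expansion at `p ≠ 0` of the coordinate `u / s` on `ℙ¹ ∖ {0}`. -/
def invCoord (p : OnePoint ℂ) : ℂ⟦X⟧ :=
  p.elim PowerSeries.X fun z => (PowerSeries.C z + PowerSeries.X)⁻¹

theorem exists_monomialExpansion_eq (d : ℕ) (hp : p ≠ (0 : ℂ)) :
    ∃ E : ℂ⟦X⟧, E.constantCoeff ≠ 0 ∧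
      ∀ j, monomialExpansion d p j = E * invCoord p ^ (d - (j : ℕ)) := by
  induction p using OnePoint.rec with
  | infty => exact ⟨1, by simp, fun j => (one_mul _).symm⟩
  | coe z =>
    have hz : (PowerSeries.C z + PowerSeries.X).constantCoeff ≠ 0 := by
      simpa using fun h : z = 0 => hp (congrArg _ h)
    refine ⟨(PowerSeries.C z + PowerSeries.X) ^ d, by simpa using pow_ne_zero d hz, fun j => ?_⟩
    change (PowerSeries.C z + PowerSeries.X) ^ (j : ℕ) = _ * (_ : ℂ⟦X⟧)⁻¹ ^ (d - (j : ℕ))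
    rw [← pow_mul_pow_sub _ (Nat.le_of_lt_succ j.2), mul_assoc, ← mul_pow,
      PowerSeries.mul_inv_cancel _ hz, one_pow, mul_one]

theorem coeff_one_invCoord_ne_zero (hp : p ≠ (0 : ℂ)) :
    PowerSeries.coeff 1 (invCoord p) ≠ 0 := by
  induction p using OnePoint.rec with
  | infty => simp [invCoord]
  | coe z =>
    have hz : z ≠ 0 := fun h => hp (congrArg _ h)
    have hinv : (invCoord z) * (PowerSeries.C z + PowerSeries.X) = 1 :=
      PowerSeries.inv_mul_cancel _ (by simpa using hz)
    have h0 : z * PowerSeries.constantCoeff (invCoord z) = 1 := by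
      simpa [mul_comm] using congrArg PowerSeries.constantCoeff hinv
    have h1 : z * PowerSeries.coeff 1 (invCoord z) +
        PowerSeries.constantCoeff (invCoord z) = 0 := by
      simpa [PowerSeries.coeff_one_mul, PowerSeries.coeff_one, PowerSeries.coeff_C, mul_comm]
        using congrArg (PowerSeries.coeff 1) hinv
    intro h
    rw [h, mul_zero, zero_add] at h1
    simp [h1] at h0

theorem constantCoeff_invCoord_ne (hp : p ≠ (0 : ℂ)) (hq : q ≠ (0 : ℂ)) (hpq : p ≠ q) :
    PowerSeries.constantCoeff (invCoord p) ≠ PowerSeries.constantCoeff (invCoord q) := by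
  have hcoe (z : ℂ) : PowerSeries.constantCoeff (invCoord z) = z⁻¹ := by
    simp [invCoord]
  have hinfty : PowerSeries.constantCoeff (invCoord OnePoint.infty) = 0 := by simp [invCoord]
  induction p using OnePoint.rec <;> induction q using OnePoint.rec <;>
    simp_all [eq_comm (a := (0 : ℂ))]

theorem isSolution_geom (w a : ℂ) : (LinearRecurrence.mk 1 ![w]).IsSolution fun l => a * w ^ l := by
  intro l
  simp
  ring

theorem SeparatesDivisors.exists_value_ne_zero {I : Finset (Fin (n + 1))}
    (h : SeparatesDivisors 1 I c) (hp : p ≠ (0 : ℂ)) : ∃ i ∈ I, value c p i ≠ 0 := by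
  obtain ⟨E, hE, hexp⟩ := exists_monomialExpansion_eq d hp
  by_contra! h0
  refine hE ?_
  simpa using congrFun (h _ _ (isSolution_geom (invCoord p).constantCoeff E.constantCoeff)
    fun i hi => by simpa [value_eq_sum, hexp] using h0 i hi) 0

theorem SeparatesDivisors.linearIndependent_value_value (h : SeparatesDivisors 2 Finset.univ c)
    (hp : p ≠ (0 : ℂ)) (hq : q ≠ (0 : ℂ)) (hpq : p ≠ q) :
    LinearIndependent ℂ ![value c p, value c q] := by
  obtain ⟨E, hE, hexpE⟩ := exists_monomialExpansion_eq d hp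
  obtain ⟨F, hF, hexpF⟩ := exists_monomialExpansion_eq d hq
  refine LinearIndependent.pair_iff.2 fun a b hab => ?_
  set v := (invCoord p).constantCoeff
  set w := (invCoord q).constantCoeff
  have hvw : v ≠ w := constantCoeff_invCoord_ne hp hq hpq
  have hu := h ![-(v * w), v + w]
    (fun l => a * (E.constantCoeff * v ^ l) + b * (F.constantCoeff * w ^ l))
    (fun l => by simp [Fin.sum_univ_two]; ring) fun i _ => by
      simpa [value_eq_sum, hexpE, hexpF, Finset.mul_sum, Finset.sum_add_distrib, mul_add,
        mul_left_comm _ (c _)] using congrFun hab i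
  have h0 : a * E.constantCoeff + b * F.constantCoeff = 0 := by simpa using congrFun hu 0
  have h1 : a * (E.constantCoeff * v) + b * (F.constantCoeff * w) = 0 := by
    simpa using congrFun hu 1
  have ha : a * (E.constantCoeff * (v - w)) = 0 := by linear_combination h1 - w * h0
  have hb : b * (F.constantCoeff * (w - v)) = 0 := by linear_combination h1 - v * h0
  exact ⟨(mul_eq_zero.1 ha).resolve_right (mul_ne_zero hE (sub_ne_zero.2 hvw)),
    (mul_eq_zero.1 hb).resolve_right (mul_ne_zero hF (sub_ne_zero.2 hvw.symm))⟩

theorem SeparatesDivisors.linearIndependent_value_slope (h : SeparatesDivisors 2 Finset.univ c)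
    (hp : p ≠ (0 : ℂ)) : LinearIndependent ℂ ![value c p, slope c p] := by
  obtain ⟨E, hE, hexp⟩ := exists_monomialExpansion_eq d hp
  refine LinearIndependent.pair_iff.2 fun a b hab => ?_
  set w := (invCoord p).constantCoeff
  have hu := h ![-w ^ 2, 2 * w]
    (fun l => a * PowerSeries.constantCoeff (E * invCoord p ^ l) +
      b * PowerSeries.coeff 1 (E * invCoord p ^ l))
    (fun l => by
      simp only [pow_add, pow_two, ← mul_assoc, PowerSeries.coeff_one_mul, map_mul]
      simp [Fin.sum_univ_two]
      ring) fun i _ => by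
      simpa [value_eq_sum, slope_eq_sum, hexp, Finset.mul_sum, Finset.sum_add_distrib, mul_add,
        mul_left_comm _ (c _)] using congrFun hab i
  have h0 : a * E.constantCoeff + b * PowerSeries.coeff 1 E = 0 := by simpa using congrFun hu 0
  have h1 : a * (E.constantCoeff * w) + b * (PowerSeries.coeff 1 E * w +
      PowerSeries.coeff 1 (invCoord p) * E.constantCoeff) = 0 := by
    simpa [PowerSeries.coeff_one_mul] using congrFun hu 1
  have hb : b = 0 := (mul_eq_zero.1 (by linear_combination h1 - w * h0)).resolve_right
    (mul_ne_zero (coeff_one_invCoord_ne_zero hp) hE)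
  rw [hb, zero_mul, add_zero] at h0
  exact ⟨(mul_eq_zero.1 h0).resolve_right hE, hb⟩

end Immersion

section Unicuspidal

variable {n d : ℕ}

theorem coeff_expansion_zero (c : Forms n d) (i : Fin (n + 1)) (j : Fin (d + 1)) :
    PowerSeries.coeff j (expansion c (0 : ℂ) i) = c (i, j) := by
  simp [expansion_eq_sum, monomialExpansion, PowerSeries.coeff_X_pow, Fin.val_inj]

theorem value_zero (c : Forms n d) (i : Fin (n + 1)) : value c (0 : ℂ) i = c (i, 0) :=
  (PowerSeries.coeff_zero_eq_constantCoeff_apply _).symm.trans (coeff_expansion_zero c i 0)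

/-- The vanishing orders, at a cusp with affine coordinates of orders `k`, of the homogeneous
coordinates of a morphism that takes the cusp to `(1 : 0 : ⋯ : 0)`. -/
abbrev coordOrders (k : Fin n → ℕ) : Fin (n + 1) → ℕ :=
  Fin.cons 0 k

/-- The morphism has at `0` a branch centred at `(1 : 0 : ⋯ : 0)` with affine coordinates of orders
`k`, and is an injective immersion away from it: the forms separate the divisors of degree two on
`ℙ¹ ∖ {0}`, and no other point goes to `(1 : 0 : ⋯ : 0)`. -/
structure IsUnicuspidal (k : Fin n → ℕ) (c : Forms n d) : Prop where
  apply_eq_zero : ∀ i (j : Fin (d + 1)), (j : ℕ) < coordOrders k i → c (i, j) = 0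
  apply_ne_zero : ∀ i (j : Fin (d + 1)), (j : ℕ) = coordOrders k i → c (i, j) ≠ 0
  separatesDivisors_one : SeparatesDivisors 1 (Finset.univ.erase 0) c
  separatesDivisors_two : SeparatesDivisors 2 Finset.univ c

namespace IsUnicuspidal

variable {k : Fin n → ℕ} {c : Forms n d} {p q : OnePoint ℂ}

theorem value_zero_zero_ne_zero (h : IsUnicuspidal k c) : value c (0 : ℂ) 0 ≠ 0 := by
  rw [value_zero]
  exact h.apply_ne_zero 0 0 rfl

theorem value_zero_succ (h : IsUnicuspidal k c) (hk : ∀ i, k i ≠ 0) (i : Fin n) :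
    value c (0 : ℂ) i.succ = 0 := by
  rw [value_zero]
  exact h.apply_eq_zero i.succ 0 (Nat.pos_of_ne_zero (hk i))

theorem exists_value_succ_ne_zero (h : IsUnicuspidal k c) (hp : p ≠ (0 : ℂ)) :
    ∃ i : Fin n, value c p i.succ ≠ 0 := by
  obtain ⟨i, hi, hne⟩ := h.separatesDivisors_one.exists_value_ne_zero hp
  obtain ⟨i, rfl⟩ := Fin.exists_succ_eq.2 (Finset.ne_of_mem_erase hi)
  exact ⟨i, hne⟩

theorem value_ne_zero (h : IsUnicuspidal k c) (p : OnePoint ℂ) : value c p ≠ 0 := by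
  rcases eq_or_ne p (0 : ℂ) with rfl | hp
  · exact Function.ne_iff.2 ⟨0, h.value_zero_zero_ne_zero⟩
  · obtain ⟨i, hi⟩ := h.exists_value_succ_ne_zero hp
    exact Function.ne_iff.2 ⟨i.succ, hi⟩

theorem linearIndependent_value_value (h : IsUnicuspidal k c) (hk : ∀ i, k i ≠ 0) (hpq : p ≠ q) :
    LinearIndependent ℂ ![value c p, value c q] := by
  have hzero {q : OnePoint ℂ} (hq : q ≠ (0 : ℂ)) :
      LinearIndependent ℂ ![value c (0 : ℂ), value c q] := by
    refine (LinearIndependent.pair_iff' (h.value_ne_zero _)).2 fun a ha => ?_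
    obtain ⟨i, hi⟩ := h.exists_value_succ_ne_zero hq
    exact hi (by rw [← ha, Pi.smul_apply, h.value_zero_succ hk, smul_zero])
  rcases eq_or_ne p (0 : ℂ) with rfl | hp
  · exact hzero hpq.symm
  rcases eq_or_ne q (0 : ℂ) with rfl | hq
  · exact LinearIndependent.pair_symm_iff.1 (hzero hp)
  · exact h.separatesDivisors_two.linearIndependent_value_value hp hq hpq

theorem linearIndependent_rows (h : IsUnicuspidal k c) (hk : StrictMono (coordOrders k))
    (hd : ∀ i, coordOrders k i < d + 1) :
    LinearIndependent ℂ fun (i : Fin (n + 1)) (j : Fin (d + 1)) => c (i, j) := by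
  let K (i : Fin (n + 1)) : Fin (d + 1) := ⟨coordOrders k i, hd i⟩
  have hupper : (pivotBlock K c).IsUpperTriangular := fun i j hji =>
    h.apply_eq_zero i (K j) (hk hji)
  have hdet : (pivotBlock K c).det ≠ 0 := by
    rw [Matrix.det_of_isUpperTriangular hupper]
    exact Finset.prod_ne_zero_iff.2 fun i _ => h.apply_ne_zero i (K i) rfl
  exact LinearIndependent.of_comp (LinearMap.funLeft ℂ ℂ K)
    (Matrix.linearIndependent_rows_of_det_ne_zero hdet)

theorem mem_maps (h : IsUnicuspidal k c) (hk : StrictMono (coordOrders k))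
    (hd : ∀ i, coordOrders k i < d + 1) : c ∈ maps n d :=
  ⟨h.value_ne_zero, h.linearIndependent_rows hk hd⟩

theorem mem_severi (h : IsUnicuspidal k c) (hk : StrictMono (coordOrders k))
    (hd : ∀ i, coordOrders k i < d + 1) (hfin : (valueSemigroup (germ c (0 : ℂ) 0))ᶜ.Finite)
    (hne : valueSemigroup (germ c (0 : ℂ) 0) ≠ Set.univ) :
    c ∈ severi n d (valueSemigroup (germ c (0 : ℂ) 0))ᶜ.ncard
      (valueSemigroup (germ c (0 : ℂ) 0)) := by
  have hk0 (i) : k i ≠ 0 := (hk (Fin.succ_pos i)).ne'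
  have hcusp := valueSemigroupAt_eq h.value_zero_zero_ne_zero
  have hsmooth (q : OnePoint ℂ) (hq : q ≠ (0 : ℂ)) : valueSemigroupAt c q = Set.univ :=
    valueSemigroupAt_eq_univ (h.separatesDivisors_two.linearIndependent_value_slope hq)
  refine ⟨h.mem_maps hk hd, fun p q hpq => ?_, ?_, _, hcusp, hne, hsmooth⟩
  · obtain ⟨a, ha⟩ := (Projectivization.mk_eq_mk_iff' ℂ _ _ _ _).1 hpq
    by_contra hne
    exact (LinearIndependent.pair_iff' (h.value_ne_zero q)).1
      (h.linearIndependent_value_value hk0 (Ne.symm hne)) a ha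
  · rw [arithGenus, finsum_eq_single _ ((0 : ℂ) : OnePoint ℂ) fun q hq => by
      rw [hsmooth q hq, Set.compl_univ, Set.encard_empty], hcusp, hfin.cast_ncard_eq]

end IsUnicuspidal

theorem eventually_isUnicuspidal_mask (hn : 3 ≤ n) {k : Fin n → ℕ} (hd : ∀ i, k i + 2 ≤ d + 1) :
    ∀ᶠ x in generic (Fin (n + 1) × Fin (d + 1)) ℂ,
      IsUnicuspidal k (mask (coordOrders k) x) := by
  have hd' (i) : coordOrders k i + 2 ≤ d + 1 := by
    refine Fin.cases ?_ hd i
    exact (Nat.add_le_add_right (Nat.zero_le _) 2).trans (hd ⟨0, by omega⟩)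
  filter_upwards [eventually_all.2 fun s => eventually_coord_ne_zero s,
    eventually_separatesDivisors_mask (r := 1) (k := coordOrders k) (I := Finset.univ.erase 0)
      (by simp; omega) fun i _ => (Nat.le_succ _).trans (hd' i),
    eventually_separatesDivisors_mask (r := 2) (k := coordOrders k) (I := Finset.univ)
      (by simp; omega) fun i _ => hd' i] with x hx h₁ h₂
  exact ⟨fun i j hj => mask_of_lt hj x,
    fun i j hj => (mask_of_le hj.ge x).trans_ne (hx (i, j)), h₁, h₂⟩

end Unicuspidal

section Density

section LineMap

variable {σ R : Type*} [CommRing R] [IsDomain R] {Φ : MvPolynomial σ R} {x y : σ → R}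

theorem eventually_eval_lineMap_ne_zero {r₀ : R}
    (h : eval (AffineMap.lineMap x y r₀ : σ → R) Φ ≠ 0) :
    ∀ᶠ r : R in cofinite, eval (AffineMap.lineMap x y r) Φ ≠ 0 := by
  let P : Polynomial R := MvPolynomial.aeval
    (fun s => Polynomial.X * Polynomial.C (y s - x s) + Polynomial.C (x s)) Φ
  have hP (r : R) : P.eval r = eval (AffineMap.lineMap x y r) Φ := by
    refine (MvPolynomial.polynomial_eval_eval₂ _ _ _).trans ?_
    refine MvPolynomial.eval₂Hom_congr ?_ ?_ rfl
    · ext a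
      simp
    · funext s
      simp [AffineMap.lineMap_apply]
  have hP0 : P ≠ 0 := fun h0 => h (by rw [← hP, h0, Polynomial.eval_zero])
  filter_upwards [(Polynomial.finite_setOfPred_isRoot hP0).compl_mem_cofinite] with r hr
  exact (hP r).symm.trans_ne hr

theorem frequently_generic_of_eventually_lineMap [Infinite R] {p : (σ → R) → Prop}
    (h : ∀ᶠ x in generic σ R, ∃ y, ∀ᶠ r : R in cofinite, p (AffineMap.lineMap x y r)) :
    ∃ᶠ x in generic σ R, p x := by
  refine frequently_generic_iff.2 fun Ψ hΨ => ?_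
  obtain ⟨x, ⟨y, hy⟩, hx⟩ := (h.and (eventually_eval_ne_zero hΨ)).exists
  have hx' : eval (AffineMap.lineMap x y (0 : R)) Ψ ≠ 0 := by
    rwa [AffineMap.lineMap_apply_zero]
  obtain ⟨r, hr, hpr⟩ := ((eventually_eval_lineMap_ne_zero hx').and hy).exists
  exact ⟨_, hr, hpr⟩

end LineMap

theorem mask_lineMap {ι : Type*} {N : ℕ} (k : ι → ℕ) (x y : ι × Fin N → ℂ) (r : ℂ) :
    mask k (AffineMap.lineMap x y r) = AffineMap.lineMap (mask k x) (mask k y) r := by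
  funext s
  by_cases hs : k s.1 ≤ s.2 <;> simp [mask, AffineMap.lineMap_apply, hs]

variable {n d : ℕ} {k : Fin n → ℕ}

/-- The coefficients of the power series `aᵢ`, for a morphism whose branch at `0` is parameterized
by the power series `t ^ kᵢ * aᵢ(t)`. -/
def cuspCoeff (k : Fin n → ℕ) (c : Forms n d) : Fin n × ℕ → ℂ :=
  fun s => PowerSeries.coeff (s.2 + k s.1) (germ c (0 : ℂ) 0 s.1)

theorem IsUnicuspidal.paramSeries_cuspCoeff {c : Forms n d} (h : IsUnicuspidal k c)
    (hk : ∀ i, k i ≠ 0) : paramSeries k (cuspCoeff k c) = germ c (0 : ℂ) 0 := by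
  funext i
  have hdvd : PowerSeries.X ^ k i ∣ germ c (0 : ℂ) 0 i := by
    rw [germ, Fin.succAbove_zero, h.value_zero_succ hk, zero_mul, map_zero, sub_zero,
      expansion_eq_sum]
    refine (Finset.dvd_sum fun j _ => ?_).mul_right _
    rcases lt_or_ge (j : ℕ) (k i) with hj | hj
    · rw [h.apply_eq_zero i.succ j hj, map_zero, zero_mul]
      exact dvd_zero _
    · exact (pow_dvd_pow _ hj).trans (by simp [monomialExpansion])
  obtain ⟨a, ha⟩ := hdvd
  rw [paramSeries, ha]
  congr 1
  ext j
  rw [PowerSeries.coeff_mk, cuspCoeff, ha, PowerSeries.coeff_X_pow_mul]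

theorem expansion_lineMap (c c' : Forms n d) (r : ℂ) (p : OnePoint ℂ) (i : Fin (n + 1)) :
    expansion (AffineMap.lineMap c c' r) p i =
      AffineMap.lineMap (expansion c p i) (expansion c' p i) r := by
  simp only [AffineMap.lineMap_apply_module, expansion_eq_sum, Finset.smul_sum,
    ← Finset.sum_add_distrib, PowerSeries.smul_eq_C_mul, Pi.add_apply, Pi.smul_apply, map_add,
    smul_eq_mul, map_mul, add_mul, mul_assoc]

theorem cuspCoeff_lineMap {c c' : Forms n d}
    (h : expansion c' (0 : ℂ) 0 = expansion c (0 : ℂ) 0) (r : ℂ) :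
    cuspCoeff k (AffineMap.lineMap c c' r) =
      AffineMap.lineMap (cuspCoeff k c) (cuspCoeff k c') r := by
  have h0 : expansion (AffineMap.lineMap c c' r) (0 : ℂ) 0 = expansion c (0 : ℂ) 0 := by
    rw [expansion_lineMap, h, AffineMap.lineMap_same_apply]
  funext s
  have hs := expansion_lineMap c c' r (0 : ℂ) ((0 : Fin (n + 1)).succAbove s.1)
  simp only [AffineMap.lineMap_apply_module] at hs h0 ⊢
  simp only [cuspCoeff, germ, value, h0, h, hs, Pi.add_apply, Pi.smul_apply, smul_eq_mul,
    PowerSeries.smul_eq_C_mul, map_add, map_sub, map_mul, map_one, add_mul, sub_mul, one_mul,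
    mul_assoc, PowerSeries.coeff_C_mul, PowerSeries.constantCoeff_C]
  ring

/-- The forms whose dehomogenizations are the truncations of the power series `f`. -/
def truncForms (d : ℕ) (f : Fin (n + 1) → ℂ⟦X⟧) : Forms n d :=
  fun s => PowerSeries.coeff s.2 (f s.1)

theorem coeff_expansion_truncForms (f : Fin (n + 1) → ℂ⟦X⟧) (i : Fin (n + 1)) {j : ℕ}
    (hj : j < d + 1) :
    PowerSeries.coeff j (expansion (truncForms d f) (0 : ℂ) i) = PowerSeries.coeff j (f i) :=
  coeff_expansion_zero (truncForms d f) i ⟨j, hj⟩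

theorem mask_truncForms {K : Fin (n + 1) → ℕ} {f : Fin (n + 1) → ℂ⟦X⟧}
    (h : ∀ i, K i ≤ (f i).order) : mask K (truncForms d f) = truncForms d f := by
  refine Set.indicator_eq_self.2 fun s => not_imp_comm.1 fun hs => ?_
  exact PowerSeries.coeff_of_lt_order _ ((Nat.cast_lt.2 (not_le.1 hs)).trans_le (h s.1))

theorem exists_cuspCoeff_mask_eq (hk : ∀ i, k i ≠ 0) {c : Forms n d}
    (hc : value c (0 : ℂ) 0 ≠ 0) (a : Fin n × ℕ → ℂ) :
    ∃ y : Forms n d,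
      expansion (mask (coordOrders k) y) (0 : ℂ) 0 = expansion c (0 : ℂ) 0 ∧
      ∀ s : Fin n × ℕ, s.2 + k s.1 ≤ d → cuspCoeff k (mask (coordOrders k) y) s = a s := by
  set E := expansion c (0 : ℂ) 0
  let f : Fin (n + 1) → ℂ⟦X⟧ := Fin.cons E fun i => E * paramSeries k a i
  let y := truncForms d f
  have hmask : mask (coordOrders k) y = y := mask_truncForms fun i => by
    refine Fin.cases bot_le (fun i => ?_) i
    exact (le_order_paramSeries k a i).trans (le_add_self.trans (PowerSeries.order_mul_ge _ _))
  have hy0 : expansion y (0 : ℂ) 0 = E := by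
    simp only [E, expansion_eq_sum]
    exact Finset.sum_congr rfl fun j _ => by rw [← coeff_expansion_zero c]; rfl
  refine ⟨y, by rw [hmask, hy0], fun s hs => ?_⟩
  have hdvd : PowerSeries.X ^ (d + 1) ∣ expansion y (0 : ℂ) s.1.succ - E * paramSeries k a s.1 :=
    PowerSeries.X_pow_dvd_iff.2 fun j hj => by
      rw [map_sub, coeff_expansion_truncForms f _ hj, sub_eq_zero]
      rfl
  have hdvd' : PowerSeries.X ^ (d + 1) ∣
      expansion y (0 : ℂ) s.1.succ * E⁻¹ - paramSeries k a s.1 := by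
    convert hdvd.mul_right E⁻¹ using 1
    rw [sub_mul, mul_right_comm, PowerSeries.mul_inv_cancel _ hc, one_mul]
  have hcoeff := PowerSeries.X_pow_dvd_iff.1 hdvd' (s.2 + k s.1) (Nat.lt_succ_of_le hs)
  rw [map_sub, sub_eq_zero, paramSeries, PowerSeries.coeff_X_pow_mul, PowerSeries.coeff_mk]
    at hcoeff
  rw [hmask, cuspCoeff, germ, Fin.succAbove_zero, hy0, map_sub, hcoeff, PowerSeries.coeff_C,
    if_neg (by have := hk s.1; omega), sub_zero]

theorem eventually_frequently_eval_cuspCoeff_ne_zero (hk : ∀ i, k i ≠ 0)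
    {Φ : MvPolynomial (Fin n × ℕ) ℂ} (hΦ : Φ ≠ 0) :
    ∀ᶠ d in atTop, ∃ᶠ x in generic (Fin (n + 1) × Fin (d + 1)) ℂ,
      eval (cuspCoeff k (mask (coordOrders k) x)) Φ ≠ 0 := by
  obtain ⟨a, ha⟩ := (eventually_eval_ne_zero hΦ).exists
  filter_upwards [Φ.vars.eventually_all.2 fun s _ => eventually_ge_atTop (s.2 + k s.1)] with d hd
  refine frequently_generic_of_eventually_lineMap ?_
  filter_upwards [eventually_coord_ne_zero (0, 0)] with x hx
  have hmask : value (mask (coordOrders k) x) (0 : ℂ) 0 ≠ 0 := by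
    rwa [value_zero, mask_of_le (k := coordOrders k) (i := 0) (Nat.zero_le _)]
  obtain ⟨y, hxy, hy⟩ := exists_cuspCoeff_mask_eq hk hmask a
  have hya : eval (cuspCoeff k (mask (coordOrders k) y)) Φ = eval a Φ :=
    MvPolynomial.eval₂Hom_congr' rfl (fun s hs _ => hy s (hd s hs)) rfl
  refine ⟨y, ?_⟩
  simp only [mask_lineMap, cuspCoeff_lineMap hxy]
  refine eventually_eval_lineMap_ne_zero (r₀ := 1) ?_
  rwa [AffineMap.lineMap_apply_one, hya]

end Density

theorem IsGenericValueSemigroup.mul_succ_le_ncard_compl_add_choose {n : ℕ} {k : Fin n → ℕ}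
    {S : Set ℕ} (hS : IsGenericValueSemigroup k S) (hfin : Sᶜ.Finite) {κ : ℕ} (hκ : κ ≠ 0)
    (hk : ∀ i, κ ≤ k i) (r : ℕ) : κ * (r + 1) ≤ Sᶜ.ncard + (r + n).choose n := by
  obtain ⟨a, rfl⟩ := (isGenericValueSemigroup_iff.1 hS).exists
  exact Severi.mul_succ_le_ncard_compl_add_choose hκ
    (fun i => (Nat.cast_le.2 (hk i)).trans (le_order_paramSeries k a i)) hfin r

theorem codim_severi_le {n : ℕ} (hn : 3 ≤ n) {k : Fin n → ℕ} (hk : StrictMono (coordOrders k))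
    {S : Set ℕ} (hS : IsGenericValueSemigroup k S) (hfin : Sᶜ.Finite) (hne : S ≠ Set.univ) :
    ∀ᶠ d in atTop,
      codim (severi n d Sᶜ.ncard S) (maps n d) ≤ (∑ i, (coordOrders k i - i) : ℕ) := by
  have hk0 (i) : k i ≠ 0 := (hk (Fin.succ_pos i)).ne'
  obtain ⟨Φ, hΦ, hgen⟩ := isGenericValueSemigroup_iff.1 hS
  filter_upwards [eventually_frequently_eval_cuspCoeff_ne_zero hk0 hΦ,
    eventually_all.2 fun i => eventually_ge_atTop (k i + 1)] with d hdense hd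
  have hd' (i) : coordOrders k i < d + 1 :=
    Fin.cases d.succ_pos (fun i => (hd i).trans d.le_succ) i
  refine codim_le_of_frequently_mask_mem (k := fun i => ⟨coordOrders k i, hd' i⟩) hk
    (fun c hc => hc.1) (fun A c hc => act_mem_severi A hc) ?_
  refine (hdense.and_eventually (eventually_isUnicuspidal_mask hn fun i =>
    Nat.succ_le_succ (hd i))).mono fun x hx => ?_
  have hVS : valueSemigroup (germ (mask (coordOrders k) x) (0 : ℂ) 0) = S := by
    rw [← hx.2.paramSeries_cuspCoeff hk0, hgen _ hx.1]
  subst hVS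
  exact hx.2.mem_severi hk hd' hfin hne

section CuspOrders

/-- The orders of the affine coordinates of the branches considered in the theorem. -/
abbrev cuspOrders (m : ℕ) : Fin 3 → ℕ :=
  ![2 * m, 2 * m + 2, 2 * m + 4]

variable {m : ℕ}

theorem exists_isGenericValueSemigroup_cuspOrders (hm : m ≠ 0) :
    ∃ S, IsGenericValueSemigroup (cuspOrders m) S ∧ Sᶜ.Finite := by
  have hk (i) : cuspOrders m i ≠ 0 := by
    fin_cases i <;> simp [hm]
  have hgcd : Nat.setGcd {2 * m, 2 * m + 2, 2 * (2 * m + 2) + 1} = 1 := by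
    set s : Set ℕ := {2 * m, 2 * m + 2, 2 * (2 * m + 2) + 1}
    have h₁ : Nat.setGcd s ∣ 2 * m + 2 := Nat.setGcd_dvd_of_mem (by simp [s])
    have h₂ : Nat.setGcd s ∣ 2 * (2 * m + 2) + 1 := Nat.setGcd_dvd_of_mem (by simp [s])
    exact Nat.dvd_one.1 ((Nat.dvd_add_right (h₁.mul_left 2)).1 h₂)
  refine exists_isGenericValueSemigroup hk hgcd ?_
  filter_upwards [eventually_mem_valueSemigroup hk 0, eventually_mem_valueSemigroup hk 1,
    eventually_succ_mem_valueSemigroup hk (i₀ := 0) (i₁ := 1) (i₂ := 2) (by decide) (by decide)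
      (by simp; omega)] with a h₀ h₁ h₂
  simpa [Set.insert_subset_iff] using And.intro h₀ (And.intro h₁ h₂)

theorem lt_ncard_compl_of_isGenericValueSemigroup_cuspOrders (hm : 9 ≤ m) {S : Set ℕ}
    (hS : IsGenericValueSemigroup (cuspOrders m) S) (hfin : Sᶜ.Finite) : 6 * m < Sᶜ.ncard := by
  have h : 2 * m * (4 + 1) ≤ Sᶜ.ncard + (4 + 3).choose 3 :=
    hS.mul_succ_le_ncard_compl_add_choose hfin (by omega) (fun i => by fin_cases i <;> simp) 4
  have hchoose : Nat.choose (4 + 3) 3 = 35 := rfl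
  omega

theorem eventually_codim_severi_cuspOrders_lt (hm : 9 ≤ m) :
    ∀ᶠ d in atTop, ∀ S, IsGenericValueSemigroup (cuspOrders m) S →
      codim (severi 3 d Sᶜ.ncard S) (maps 3 d) < Sᶜ.ncard := by
  obtain ⟨S, hS, hfin⟩ := exists_isGenericValueSemigroup_cuspOrders (m := m) (by omega)
  have hlt := lt_ncard_compl_of_isGenericValueSemigroup_cuspOrders hm hS hfin
  have hne : S ≠ Set.univ := by
    rintro rfl
    simp at hlt
  have hmono : StrictMono (coordOrders (cuspOrders m)) := by
    simp [Fin.strictMono_iff_lt_succ, Fin.forall_fin_succ]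
    omega
  have hsum : ∑ i, (coordOrders (cuspOrders m) i - (i : ℕ)) = 6 * m := by
    simp [Fin.sum_univ_succ]
    omega
  filter_upwards [codim_severi_le le_rfl hmono hS hfin hne] with d hd S' hS'
  obtain rfl := hS.unique hS'
  exact hd.trans_lt (by rw [hsum]; exact_mod_cast hlt)

end CuspOrders

end

end Severi

theorem corollary3p17 :
    ∃ D : ℕ → ℕ, ∀ m : ℕ, 9 ≤ m →
      (∃! S : Set ℕ, Severi.IsGenericValueSemigroup ![2 * m, 2 * m + 2, 2 * m + 4] S) ∧
      ∀ S : Set ℕ, Severi.IsGenericValueSemigroup ![2 * m, 2 * m + 2, 2 * m + 4] S →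
        Sᶜ.Finite ∧
        ∀ g : ℕ, g = Sᶜ.ncard → ∀ d : ℕ, D g ≤ d →
          Severi.codim (Severi.severi 3 d g S) (Severi.maps 3 d) < (g : ℕ∞) := by
  have hlarge (g : ℕ) := (Finset.Icc 9 g).eventually_all.2 fun m hm =>
    Severi.eventually_codim_severi_cuspOrders_lt (Finset.mem_Icc.1 hm).1
  choose D hD using fun g => Filter.eventually_atTop.1 (hlarge g)
  refine ⟨D, fun m hm => ?_⟩
  obtain ⟨S, hS, hfin⟩ := Severi.exists_isGenericValueSemigroup_cuspOrders (m := m) (by omega)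
  refine ⟨⟨S, hS, fun S' hS' => hS'.unique hS⟩, fun S' hS' => ?_⟩
  obtain rfl := hS.unique hS'
  refine ⟨hfin, ?_⟩
  rintro g rfl d hd
  have hlt := Severi.lt_ncard_compl_of_isGenericValueSemigroup_cuspOrders hm hS hfin
  exact hD _ d hd m (Finset.mem_Icc.2 ⟨hm, by omega⟩) S hS
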